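/- Let $n\ge 0$, let $a=(a_{ij})_{1\le i\le j\le n+1}$ be positive real parameters, and let $$\mathrm{Ass}(a)=\sum_{1\le i\le j\le n+1}a_{ij}\,\Delta_{[i,\dots,j]}\subset\mathbb R^{n+1},\qquad \Delta_{[i,\dots,j]}=\mathrm{conv}\{e_i,e_{i+1},\dots,e_j\},$$ be the Minkowski sum of the dilated simplices. Let $Q$ be a strictly convex $(n+3)$-gon in the plane with vertices labeled $0,1,\dots,n+2$ in counterclockwise order. A subdivision of $Q$ is a polyhedral subdivision of $Q$ without new vertices, i.e. a set of two-dimensional polygons, each spanned by vertices of $Q$, that cover $Q$ and any two of which intersect in a common (possibly empty) face. Subdivisions are ordered by refinement, the finer one being smaller, and a formal least element $\bot$ (corresponding to the empty face of a polytope) is adjoined to obtain the lattice of subdivisions of $Q$. For a linear function $w=(w_1,\dots,w_{n+1})\in(\mathbb R^{n+1})^*$ let $F_w$ be the face of $\mathrm{Ass}(a)$ on which $w$ is maximal. Put $w_0=w_{n+2}=\infty$, and for $k=0,\dots,n+2$ let $H_k$ be the convex hull of the vertices $i$ of $Q$ with $w_i\ge w_k$. The subdivision of $Q$ induced by $H_k$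 has as its cells the two-dimensional ones among $H_k$ and the parts of $Q$ cut off by the edges of $H_k$ (it is the trivial subdivision $\{Q\}$ if $H_k$ is just the side of $Q$ joining $0$ and $n+2$). Let $S_w$ be the common refinement of the subdivisions induced by $H_0,\dots,H_{n+2}$; its cells are the two-dimensional intersections of one cell from each of them. Then every $S_w$ is a subdivision of $Q$, and $F_w\mapsto S_w$ (together with $\emptyset\mapsto\bot$) is a well-defined bijection from the face lattice of $\mathrm{Ass}(a)$, ordered by inclusion, to the lattice of subdivisions of $Q$, which preserves the order in both directions. In particular, $\mathrm{Ass}(a)$ is an $n$-dimensional associahedron: a simple $n$-dimensional polytope whose face lattice is isomorphic to the lattice of subdivisions of a convex $(n+3)$-gon. -/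

import Mathlib

open scoped Pointwise

/-! ### Polytopes and their faces -/

/-- The face lattice of a polytope `P`: all its faces, ordered by inclusion. `IsExposed ℝ P F` says
that `F` is empty or the set of points of `P` that maximize a linear function; so the empty face and
`P` itself are included. -/
abbrev FaceLattice {E : Type*} [AddCommGroup E] [Module ℝ E] [TopologicalSpace E] (P : Set E) :
    Type _ :=
  {F : Set E // IsExposed ℝ P F}

/-- A polytope is the convex hull of finitely many points. -/
def IsPolytope {E : Type*} [AddCommGroup E] [Module ℝ E] (P : Set E) : Prop :=
  ∃ s : Set E, s.Finite ∧ P = convexHull ℝ s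

/-- A facet is a maximal proper face. -/
def IsFacet {E : Type*} [AddCommGroup E] [Module ℝ E] [TopologicalSpace E] (P F : Set E) : Prop :=
  Maximal (fun G : Set E => IsExposed ℝ P G ∧ G ≠ P) F

/-- `P` is a simple polytope of dimension `d`: its affine hull has dimension `d`, and every vertex
lies in exactly `d` facets. -/
def IsSimplePolytope {E : Type*} [AddCommGroup E] [Module ℝ E] [TopologicalSpace E]
    (d : ℕ) (P : Set E) : Prop :=
  IsPolytope P ∧ P.Nonempty ∧ Module.finrank ℝ (vectorSpan ℝ P) = d ∧
    ∀ v ∈ P.extremePoints ℝ, {F : Set E | IsFacet P F ∧ v ∈ F}.encard = d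

/-! ### Convex polygons and their subdivisions -/

/-- The plane `ℝ²`. -/
abbrev Plane : Type := Fin 2 → ℝ

/-- `p 0, …, p (m - 1)` are the vertices of a strictly convex polygon, listed counterclockwise:
every triple taken in this order is positively oriented. -/
def IsConvexPolygon {m : ℕ} (p : Fin m → Plane) : Prop :=
  ∀ i j k : Fin m, i < j → j < k →
    0 < (p j 0 - p i 0) * (p k 1 - p i 1) - (p j 1 - p i 1) * (p k 0 - p i 0)

/-- A polyhedral subdivision, without new vertices, of the polygon with vertices `p i`, given by its
two-dimensional cells: they are convex hulls of vertices of the polygon, they cover the polygon, and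
any two of them intersect in a common (possibly empty) face. -/
structure Subdivision {m : ℕ} (p : Fin m → Plane) where
  cells : Set (Set Plane)
  exists_vertices : ∀ C ∈ cells, ∃ A : Set (Fin m), C = convexHull ℝ (p '' A)
  interior_nonempty : ∀ C ∈ cells, (interior C).Nonempty
  sUnion_cells : ⋃₀ cells = convexHull ℝ (Set.range p)
  isExposed_inter : ∀ C ∈ cells, ∀ D ∈ cells, IsExposed ℝ C (C ∩ D) ∧ IsExposed ℝ D (C ∩ D)

/-- Subdivisions are ordered by refinement: `S ≤ T` if every cell of `S` lies in a cell of `T`. -/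
instance Subdivision.instPreorder {m : ℕ} (p : Fin m → Plane) : Preorder (Subdivision p) where
  le S T := ∀ C ∈ S.cells, ∃ D ∈ T.cells, C ⊆ D
  le_refl _ C hC := ⟨C, hC, subset_rfl⟩
  le_trans _ _ _ h₁ h₂ C hC :=
    let ⟨D, hD, hCD⟩ := h₁ C hC
    let ⟨E, hE, hDE⟩ := h₂ D hD
    ⟨E, hE, hCD.trans hDE⟩

/-- The lattice of subdivisions of a polygon ordered by refinement. As usual, a formal least element
`⊥` is adjoined: it is the counterpart of the empty face of a polytope. -/
abbrev SubdivisionLattice {m : ℕ} (p : Fin m → Plane) : Type :=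
  WithBot (Subdivision p)

/-- The two-dimensional cells of the subdivision of the polygon `Q` that is induced by a polygon `H`
spanned by vertices of `Q` (possibly only a segment): `H` itself, and for each edge of `H` the part
of `Q` beyond that edge. The edges of `H` are the faces `l.toExposed H`, with `l` a nonzero
linear function, that have more than one point. -/
def inducedCells (Q H : Set Plane) : Set (Set Plane) :=
  {C | (interior C).Nonempty ∧
    (C = H ∨ ∃ l : StrongDual ℝ Plane, l ≠ 0 ∧ (l.toExposed H).Nontrivial ∧
      C = {x ∈ Q | ∀ y ∈ H, l y ≤ l x})}

/-- The two-dimensional cells of the common refinement of a family of subdivisions: the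
intersections of one cell from each of them, as far as they are two-dimensional. -/
def commonRefinement {ι : Type*} (𝒞 : ι → Set (Set Plane)) : Set (Set Plane) :=
  {C | (interior C).Nonempty ∧ ∃ c : ι → Set Plane, (∀ k, c k ∈ 𝒞 k) ∧ C = ⋂ k, c k}

/-- An associahedron of dimension `n`: a simple `n`-dimensional polytope whose face lattice is
isomorphic to the lattice of subdivisions of a convex `(n + 3)`-gon, whichever the polygon. -/
def IsAssociahedron {E : Type*} [AddCommGroup E] [Module ℝ E] [TopologicalSpace E]
    (n : ℕ) (P : Set E) : Prop :=
  IsSimplePolytope n P ∧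
    ∀ p : Fin (n + 3) → Plane, IsConvexPolygon p → Nonempty (FaceLattice P ≃o SubdivisionLattice p)

/-! ### The Minkowski sum and the correspondence -/

/-- The simplex spanned by the standard basis vectors `e_k` with `i ≤ k ≤ j` in `ℝⁿ⁺¹`. Coordinates
are indexed by `0, …, n` instead of `1, …, n + 1`. -/
def intervalSimplex {n : ℕ} (i j : Fin (n + 1)) : Set (Fin (n + 1) → ℝ) :=
  convexHull ℝ ((fun k : Fin (n + 1) => Pi.single k (1 : ℝ)) '' Set.Icc i j)

/-- The Minkowski sum of the dilated simplices `a i j • intervalSimplex i j` over all `i ≤ j`. -/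
noncomputable def minkowskiAss {n : ℕ} (a : Fin (n + 1) → Fin (n + 1) → ℝ) :
    Set (Fin (n + 1) → ℝ) :=
  ∑ i, ∑ j ∈ Finset.Ici i, a i j • intervalSimplex i j

/-- The face of the Minkowski sum on which the linear function `w` is maximal. -/
noncomputable def maxFace {n : ℕ} (a : Fin (n + 1) → Fin (n + 1) → ℝ)
    (w : StrongDual ℝ (Fin (n + 1) → ℝ)) : FaceLattice (minkowskiAss a) :=
  ⟨w.toExposed (minkowskiAss a), ContinuousLinearMap.toExposed.isExposed⟩

/-- The weights on the vertices `0, …, n + 2` of the polygon: `∞` at `0` and at `n + 2`, and the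
coordinates of `w` in between. -/
def vertexWeight {n : ℕ} (w : StrongDual ℝ (Fin (n + 1) → ℝ)) : Fin (n + 3) → WithTop ℝ :=
  Fin.cons ⊤ (Fin.snoc (fun i : Fin (n + 1) => ((w (Pi.single i 1) : ℝ) : WithTop ℝ)) ⊤)

/-- The polygon `H_k` spanned by the vertices whose weight is at least that of the vertex `k`. -/
def levelPolygon {n : ℕ} (p : Fin (n + 3) → Plane) (w : StrongDual ℝ (Fin (n + 1) → ℝ))
    (k : Fin (n + 3)) : Set Plane :=
  convexHull ℝ (p '' {i | vertexWeight w k ≤ vertexWeight w i})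

/-- The cells of `S_w`: the common refinement of the subdivisions induced by all the `H_k`. -/
def levelCells {n : ℕ} (p : Fin (n + 3) → Plane) (w : StrongDual ℝ (Fin (n + 1) → ℝ)) :
    Set (Set Plane) :=
  commonRefinement fun k => inducedCells (convexHull ℝ (Set.range p)) (levelPolygon p w k)

/-! Everything is encoded by chords. Give the vertices of the polygon the weights
$w_0,\dots,w_{n+2}$. A pair $l<r$ with vertices in between is a chord if all of these are lighter
than both $l$ and $r$. The base side from $0$ to $n+2$ is always a chord, because its ends have
weight $\infty$. The other chords are the diagonals of $S_w$, and the cell behind a chord is spanned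
by its ends and the heaviest vertices between them.

Faces. A linear function is maximal at a point of a Minkowski sum iff it is maximal at every summand
of that point. All $a_{ij}$ are positive, so $F_w\subseteq F_{w'}$ iff on every interval each
maximum of $w$ is a maximum of $w'$ (`toExposed_minkowskiAss_subset_iff`). By
`Peaked.isChord_imp_iff` this says that every chord of $w'$ is a chord of $w$.

Subdivisions. Chords do not cross, and their cells form a subdivision (`chordSubdivision`).
Refinement of such subdivisions is again reverse inclusion of chords (`chordSubdivision_le_iff`),
because the chords are exactly the pairs that cut no cell. `commonRefinement_inducedCells`
identifies this subdivision with $S_w$. Thus $F_w\mapsto S_w$ is well defined and preserves and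
reflects the order.

Surjectivity. The diagonals of any subdivision do not cross (`Subdivision.not_crossing`) and
determine it (`Subdivision.eq_chordSubdivision`). A noncrossing family is the set of chords of the
weight that is minus the number of members enclosing a vertex (`Peaked.isChord_iff_of_noncrossing`);
the base side comes for free.

Simplicity. Facets belong to single diagonals. At a vertex of the polytope the maximum on every
interval is unique, so sending an inner vertex to the chord formed by the nearest heavier vertices
is a bijection from the $n+1$ inner vertices to the chords (`Peaked.encard_isChord`). Without the
base side there remain $n$ diagonals, hence $n$ facets. -/

/-! ### Chords of a weight function on a finite linear order -/

section Chords

open Set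

variable {ι α : Type*} [LinearOrder ι] [LinearOrder α]

/-- `l < r` span a chord of the weight function `v` if there are elements strictly between them and
all of these have smaller weight than `l` and `r`. -/
def IsChord (v : ι → α) (l r : ι) : Prop :=
  (Ioo l r).Nonempty ∧ ∀ k ∈ Ioo l r, v k < v l ∧ v k < v r

/-- The end points of a chord, together with the elements of maximal weight between them. -/
def chordCell (v : ι → α) (l r : ι) : Set ι :=
  {k | k = l ∨ k = r ∨ (k ∈ Ioo l r ∧ ∀ j ∈ Ioo l r, v j ≤ v k)}

/-- The weights of the two extreme elements exceed all others. -/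
def Peaked [BoundedOrder ι] (v : ι → α) : Prop :=
  ∀ k, k ≠ ⊥ → k ≠ ⊤ → v k < v ⊥ ∧ v k < v ⊤

/-- Used with `A` the vertex set of a polygon: an index outside `A` lies behind a unique side, and
this side joins the nearest members of `A`. -/
lemma exists_adjacent [Finite ι] {A : Set ι} {l m r : ι} (hm : m ∉ A) (hl : l ∈ A) (hlm : l < m)
    (hr : r ∈ A) (hmr : m < r) :
    ∃ i ∈ A, ∃ j ∈ A, l ≤ i ∧ i < m ∧ m < j ∧ j ≤ r ∧ ∀ k ∈ Ioo i j, k ∉ A := by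
  obtain ⟨i, hi, hi'⟩ := Set.exists_max_image {i | i ∈ A ∧ i < m} id (Set.toFinite _) ⟨l, hl, hlm⟩
  obtain ⟨j, hj, hj'⟩ := Set.exists_min_image {j | j ∈ A ∧ m < j} id (Set.toFinite _) ⟨r, hr, hmr⟩
  refine ⟨i, hi.1, j, hj.1, hi' l ⟨hl, hlm⟩, hi.2, hj.2, hj' r ⟨hr, hmr⟩, fun k hk hkA => ?_⟩
  rcases lt_trichotomy k m with h | h | h
  · exact absurd (hi' k ⟨hkA, h⟩) (not_le.2 hk.1)
  · exact hm (h ▸ hkA)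
  · exact absurd (hj' k ⟨hkA, h⟩) (not_le.2 hk.2)

lemma IsChord.lt {v : ι → α} {l r : ι} (h : IsChord v l r) : l < r :=
  let ⟨_, hk⟩ := h.1
  hk.1.trans hk.2

lemma left_mem_chordCell (v : ι → α) (l r : ι) : l ∈ chordCell v l r := Or.inl rfl

lemma right_mem_chordCell (v : ι → α) (l r : ι) : r ∈ chordCell v l r := Or.inr (Or.inl rfl)

lemma chordCell_subset_Icc {v : ι → α} {l r : ι} (h : l < r) : chordCell v l r ⊆ Icc l r := by
  rintro k (rfl | rfl | hk)
  · exact ⟨le_rfl, h.le⟩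
  · exact ⟨h.le, le_rfl⟩
  · exact ⟨hk.1.1.le, hk.1.2.le⟩

lemma IsChord.exists_argmax [Finite ι] {v : ι → α} {l r : ι} (h : IsChord v l r) :
    ∃ k ∈ Ioo l r, ∀ j ∈ Ioo l r, v j ≤ v k :=
  Set.exists_max_image _ v (Set.toFinite _) h.1

lemma IsChord.not_crossing {v : ι → α} {l r l' r' : ι} (h : IsChord v l r) (h' : IsChord v l' r')
    (h₁ : l < l') (h₂ : l' < r) (h₃ : r < r') : False :=
  lt_asymm (h.2 l' ⟨h₁, h₂⟩).2 (h'.2 r ⟨h₂, h₃⟩).1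

lemma isChord_bot_top [BoundedOrder ι] {v : ι → α} (hv : Peaked v)
    (h : (Ioo (⊥ : ι) ⊤).Nonempty) : IsChord v ⊥ ⊤ :=
  ⟨h, fun k hk => hv k hk.1.ne' hk.2.ne⟩

/-- The nearest elements of larger weight on both sides span a chord. -/
lemma Peaked.exists_isChord [Finite ι] [BoundedOrder ι] {v : ι → α} (hv : Peaked v) {k : ι}
    (hk : k ∈ Ioo ⊥ ⊤) :
    ∃ l r, IsChord v l r ∧ k ∈ Ioo l r ∧ ∀ j ∈ Ioo l r, v j ≤ v k := by
  obtain ⟨h₁, h₂⟩ := hv k hk.1.ne' hk.2.ne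
  obtain ⟨i, hi, j, hj, -, hik, hkj, -, hA⟩ :=
    exists_adjacent (A := {j | v k < v j}) (lt_irrefl _) h₁ hk.1 h₂ hk.2
  have hA' : ∀ x ∈ Ioo i j, v x ≤ v k := fun x hx => not_lt.1 (hA x hx)
  exact ⟨i, j, ⟨⟨k, hik, hkj⟩, fun x hx => ⟨(hA' x hx).trans_lt hi, (hA' x hx).trans_lt hj⟩⟩,
    ⟨hik, hkj⟩, hA'⟩

/-- Two consecutive elements of the cell of a chord span a chord. -/
lemma IsChord.of_adjacent {v : ι → α} {l r i j : ι} (h : IsChord v l r)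
    (hi : i ∈ chordCell v l r) (hj : j ∈ chordCell v l r) (hne : (Ioo i j).Nonempty)
    (hA : ∀ k ∈ Ioo i j, k ∉ chordCell v l r) : IsChord v i j := by
  have hi' := chordCell_subset_Icc h.lt hi
  have hj' := chordCell_subset_Icc h.lt hj
  refine ⟨hne, fun k hk => ?_⟩
  have hk' : k ∈ Ioo l r := ⟨hi'.1.trans_lt hk.1, hk.2.trans_le hj'.2⟩
  have key : ∀ x ∈ chordCell v l r, v k < v x := by
    rintro x (rfl | rfl | hx)
    · exact (h.2 k hk').1
    · exact (h.2 k hk').2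
    · refine lt_of_le_of_ne (hx.2 k hk') fun he => hA k hk (Or.inr (Or.inr ⟨hk', ?_⟩))
      rw [he]
      exact hx.2
  exact ⟨key i hi, key j hj⟩

/-- The descent step for innermost chords: whatever is missing from a cell lies behind a strictly
smaller chord. It is smaller because the cell contains a heaviest element strictly between `l` and
`r`. -/
lemma IsChord.exists_adjacent_isChord [Finite ι] {v : ι → α} {l r m : ι} (h : IsChord v l r)
    (hm : m ∈ Ioo l r) (hmA : m ∉ chordCell v l r) :
    ∃ i ∈ chordCell v l r, ∃ j ∈ chordCell v l r, IsChord v i j ∧ l ≤ i ∧ j ≤ r ∧ m ∈ Ioo i j ∧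
      (∀ k ∈ Ioo i j, k ∉ chordCell v l r) ∧ ¬ (i = l ∧ j = r) := by
  obtain ⟨i, hi, j, hj, hli, him, hmj, hjr, hA⟩ := exists_adjacent hmA (left_mem_chordCell v l r)
    hm.1 (right_mem_chordCell v l r) hm.2
  refine ⟨i, hi, j, hj, h.of_adjacent hi hj ⟨m, him, hmj⟩ hA, hli, hjr, ⟨him, hmj⟩, hA, ?_⟩
  rintro ⟨rfl, rfl⟩
  obtain ⟨k, hk, hk'⟩ := h.exists_argmax
  exact hA k hk (Or.inr (Or.inr ⟨hk, hk'⟩))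

/-- A chord does not cut the cell of another chord. -/
lemma IsChord.not_cut {v : ι → α} {i j l r : ι} (h : IsChord v i j) (h' : IsChord v l r) :
    chordCell v l r ⊆ Icc i j ∨ Disjoint (chordCell v l r) (Ioo i j) := by
  by_cases hd : Disjoint (chordCell v l r) (Ioo i j)
  · exact Or.inr hd
  left
  obtain ⟨k, hk, hkij⟩ := Set.not_disjoint_iff.1 hd
  suffices i ≤ l ∧ r ≤ j from (chordCell_subset_Icc h'.lt).trans (Set.Icc_subset_Icc this.1 this.2)
  rcases hk with rfl | rfl | ⟨hk, hmax⟩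
  · exact ⟨hkij.1.le, not_lt.1 fun hj => h.not_crossing h' hkij.1 hkij.2 hj⟩
  · exact ⟨not_lt.1 fun hi => h'.not_crossing h hi hkij.1 hkij.2, hkij.2.le⟩
  · refine ⟨not_lt.1 fun hi => ?_, not_lt.1 fun hj => ?_⟩
    · exact absurd (hmax i ⟨hi, hkij.1.trans hk.2⟩) (not_le.2 (h.2 k hkij).1)
    · exact absurd (hmax j ⟨hk.1.trans hkij.2, hj⟩) (not_le.2 (h.2 k hkij).2)

/-- Dualizing the first factor turns the product order into inclusion of intervals, so that an
innermost pair is a minimal element of a finite set. -/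
lemma exists_minimal_pair [Finite ι] {T : ι → ι → Prop} {l r : ι} (h : T l r) :
    ∃ g g', T g g' ∧ ∀ i j, T i j → g ≤ i → j ≤ g' → i = g ∧ j = g' := by
  obtain ⟨x, hx⟩ := Set.Finite.exists_minimal
    (s := {x : ιᵒᵈ × ι | T (OrderDual.ofDual x.1) x.2}) (Set.toFinite _)
    ⟨(OrderDual.toDual l, r), h⟩
  refine ⟨OrderDual.ofDual x.1, x.2, hx.1, fun i j hij hi hj => ?_⟩
  have := hx.2 (y := (OrderDual.toDual i, j)) hij ⟨hi, hj⟩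
  exact ⟨le_antisymm this.1 hi, le_antisymm hj this.2⟩

/-- A pair that does not cut the cell of any chord is a chord. -/
lemma Peaked.isChord_of_not_cut [Finite ι] [BoundedOrder ι] {v : ι → α} (hv : Peaked v) {l r : ι}
    (hlr : (Ioo l r).Nonempty)
    (H : ∀ g g', IsChord v g g' →
      chordCell v g g' ⊆ Icc l r ∨ Disjoint (chordCell v g g') (Ioo l r)) :
    IsChord v l r := by
  obtain ⟨m, hm⟩ := hlr
  have h₀ : IsChord v ⊥ ⊤ := isChord_bot_top hv ⟨m, bot_le.trans_lt hm.1, hm.2.trans_le le_top⟩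
  -- Take the innermost chord around `[l, r]`. If its cell missed the open interval, the side of the
  -- cell above `m` would be a smaller such chord.
  obtain ⟨g, g', ⟨hg, hgl, hgr⟩, hmin⟩ := exists_minimal_pair
    (T := fun g g' => IsChord v g g' ∧ g ≤ l ∧ r ≤ g') ⟨h₀, bot_le, le_top⟩
  rcases H g g' hg with h | h
  · have h₁ := h (left_mem_chordCell v g g')
    have h₂ := h (right_mem_chordCell v g g')
    rwa [le_antisymm hgl h₁.1, le_antisymm h₂.2 hgr] at hg
  · have hmA : m ∉ chordCell v g g' := fun hmA => Set.disjoint_left.1 h hmA hm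
    obtain ⟨i, hi, j, hj, hij, hgi, hjg, hmij, -, hne⟩ :=
      hg.exists_adjacent_isChord ⟨hgl.trans_lt hm.1, hm.2.trans_le hgr⟩ hmA
    refine absurd (hmin i j ⟨hij, not_lt.1 fun hl => ?_, not_lt.1 fun hr => ?_⟩ hgi hjg) hne
    · exact Set.disjoint_left.1 h hi ⟨hl, hmij.1.trans hm.2⟩
    · exact Set.disjoint_left.1 h hj ⟨hm.1.trans hmij.2, hr⟩

/-- If there are fewer chords, the cells become larger. -/
lemma IsChord.exists_chordCell_subset [Finite ι] [BoundedOrder ι] {β : Type*} [LinearOrder β]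
    {v : ι → α} {v' : ι → β} (hv' : Peaked v')
    (H : ∀ i j, IsChord v' i j → IsChord v i j) {l r : ι} (h : IsChord v l r) :
    ∃ g g', IsChord v' g g' ∧ chordCell v l r ⊆ chordCell v' g g' := by
  obtain ⟨m, hm⟩ := h.1
  have h₀ : IsChord v' ⊥ ⊤ := isChord_bot_top hv' ⟨m, bot_le.trans_lt hm.1, hm.2.trans_le le_top⟩
  obtain ⟨g, g', ⟨hg, hgl, hgr⟩, hmin⟩ := exists_minimal_pair
    (T := fun g g' => IsChord v' g g' ∧ g ≤ l ∧ r ≤ g') ⟨h₀, bot_le, le_top⟩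
  refine ⟨g, g', hg, fun k hk => by_contra fun hkA => ?_⟩
  have hk' := chordCell_subset_Icc h.lt hk
  have hkg : k ≠ g := fun e => hkA (Or.inl e)
  have hkg' : k ≠ g' := fun e => hkA (Or.inr (Or.inl e))
  obtain ⟨i, -, j, -, hij, hgi, hjg, hkij, -, hne⟩ := hg.exists_adjacent_isChord
    ⟨(hgl.trans hk'.1).lt_of_ne' hkg, (hk'.2.trans hgr).lt_of_ne hkg'⟩ hkA
  rcases (H i j hij).not_cut h with h₁ | h₁
  · exact hne (hmin i j ⟨hij, (h₁ (left_mem_chordCell v l r)).1,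
      (h₁ (right_mem_chordCell v l r)).2⟩ hgi hjg)
  · exact Set.disjoint_left.1 h₁ hk hkij

/-- Chords determine, and are determined by, the positions of the maxima on all intervals. -/
lemma Peaked.isChord_imp_iff [Finite ι] [BoundedOrder ι] {v v' : ι → α} (hv : Peaked v)
    (hv' : Peaked v') :
    (∀ i j, IsChord v' i j → IsChord v i j) ↔
      ∀ i j, ⊥ < i → j < ⊤ → ∀ k ∈ Icc i j, (∀ m ∈ Icc i j, v m ≤ v k) →
        ∀ m ∈ Icc i j, v' m ≤ v' k := by
  constructor
  · intro H i j hi hj k hk hmax x hx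
    by_contra! hlt
    -- The chord of `v'` around `k` leaves out the heavier `x`, so one of its ends lies between `k`
    -- and `x`. As an end of a chord of `v` it outweighs `k`, which contradicts the maximality of
    -- `k`.
    obtain ⟨l, r, hlr, hk', hle⟩ := hv'.exists_isChord ⟨hi.trans_le hk.1, hk.2.trans_lt hj⟩
    have hxlr : x ∉ Ioo l r := fun h => absurd (hle x h) (not_le.2 hlt)
    have hc := (H l r hlr).2 k hk'
    rcases lt_trichotomy x k with h | h | h
    · have : x ≤ l := not_lt.1 fun hl => hxlr ⟨hl, h.trans hk'.2⟩
      exact absurd (hmax l ⟨hx.1.trans this, hk'.1.le.trans hk.2⟩) (not_le.2 hc.1)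
    · exact absurd hlt (by simp [h])
    · have : r ≤ x := not_lt.1 fun hl => hxlr ⟨hk'.1.trans h, hl⟩
      exact absurd (hmax r ⟨hk.1.trans hk'.2.le, this.trans hx.2⟩) (not_le.2 hc.2)
  · intro H l r h
    refine ⟨h.1, fun k hk => ⟨?_, ?_⟩⟩
    · rcases eq_or_ne l ⊥ with rfl | hl
      · exact (hv k hk.1.ne' (hk.2.trans_le le_top).ne).1
      by_contra! hlt
      -- If `l` is not heavier than `k`, then a maximum of `v` on `(l, k]` is one on `[l, k]`. It
      -- would then maximize `v'` there, although `l` is heavier for `v'`. The case `l = ⊥` is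
      -- separate because only intervals of inner elements are compared.
      obtain ⟨k', hk', hmax⟩ := Set.exists_max_image (Ioc l k) v (Set.toFinite _)
        ⟨k, hk.1, le_rfl⟩
      have := H l k (bot_lt_iff_ne_bot.2 hl) (hk.2.trans_le le_top) k' ⟨hk'.1.le, hk'.2⟩
        (fun m hm => by
          rcases hm.1.eq_or_lt with rfl | hm'
          · exact hlt.trans (hmax k ⟨hk.1, le_rfl⟩)
          · exact hmax m ⟨hm', hm.2⟩) l ⟨le_rfl, hk.1.le⟩
      exact absurd this (not_le.2 (h.2 k' ⟨hk'.1, hk'.2.trans_lt hk.2⟩).1)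
    · rcases eq_or_ne r ⊤ with rfl | hr
      · exact (hv k (bot_le.trans_lt hk.1).ne' hk.2.ne).2
      by_contra! hlt
      obtain ⟨k', hk', hmax⟩ := Set.exists_max_image (Ico k r) v (Set.toFinite _)
        ⟨k, le_rfl, hk.2⟩
      have := H k r (bot_le.trans_lt hk.1) (lt_top_iff_ne_top.2 hr) k' ⟨hk'.1, hk'.2.le⟩
        (fun m hm => by
          rcases hm.2.eq_or_lt with rfl | hm'
          · exact hlt.trans (hmax k ⟨le_rfl, hk.2⟩)
          · exact hmax m ⟨hm.1, hm'⟩) r ⟨hk.2.le, le_rfl⟩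
      exact absurd this (not_le.2 (h.2 k' ⟨hk.1.trans_le hk'.1, hk'.2⟩).2)

/-- If the weights decrease with the number of pairs of a noncrossing family that strictly
enclose an element, then the chords are the members of the family. -/
lemma Peaked.isChord_iff_of_noncrossing [Finite ι] [BoundedOrder ι] {v : ι → α} (hv : Peaked v)
    (hι : (Ioo (⊥ : ι) ⊤).Nonempty) {N : Set (ι × ι)} (hN : ∀ d ∈ N, (Ioo d.1 d.2).Nonempty)
    (hcross : ∀ d ∈ N, ∀ e ∈ N, d.1 < e.1 → e.1 < d.2 → d.2 < e.2 → False)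
    (hcount : ∀ i ∈ Ioo (⊥ : ι) ⊤, ∀ j ∈ Ioo (⊥ : ι) ⊤,
      v i < v j ↔ {d ∈ N | j ∈ Ioo d.1 d.2}.ncard < {d ∈ N | i ∈ Ioo d.1 d.2}.ncard) (l r : ι) :
    IsChord v l r ↔ (l = ⊥ ∧ r = ⊤) ∨ (l, r) ∈ N := by
  have key : ∀ l r, (l, r) ∈ N → IsChord v l r := by
    refine fun l r h => ⟨hN _ h, fun k hk => ⟨?_, ?_⟩⟩
    · rcases eq_or_ne l ⊥ with rfl | hl
      · exact (hv k hk.1.ne' (hk.2.trans_le le_top).ne).1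
      refine (hcount k ⟨bot_le.trans_lt hk.1, hk.2.trans_le le_top⟩ l
        ⟨bot_lt_iff_ne_bot.2 hl, (hk.1.trans hk.2).trans_le le_top⟩).2
        (Set.ncard_lt_ncard ⟨?_, fun hs => ?_⟩)
      -- By noncrossing, a member around `l` also encloses `k`; the member `(l, r)` encloses `k` but
      -- not `l`.
      · rintro d ⟨hd, hd'⟩
        exact ⟨hd, hd'.1.trans hk.1,
          hk.2.trans_le (not_lt.1 fun hr => hcross d hd _ h hd'.1 hd'.2 hr)⟩
      · exact lt_irrefl _ (hs (a := (l, r)) ⟨h, hk⟩).2.1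
    · rcases eq_or_ne r ⊤ with rfl | hr
      · exact (hv k (bot_le.trans_lt hk.1).ne' hk.2.ne).2
      refine (hcount k ⟨bot_le.trans_lt hk.1, hk.2.trans_le le_top⟩ r
        ⟨bot_le.trans_lt (hk.1.trans hk.2), lt_top_iff_ne_top.2 hr⟩).2
        (Set.ncard_lt_ncard ⟨?_, fun hs => ?_⟩)
      · rintro d ⟨hd, hd'⟩
        exact ⟨hd, (not_lt.1 fun hl => hcross _ h d hd hl hd'.1 hd'.2).trans_lt hk.1,
          hk.2.trans hd'.2⟩
      · exact lt_irrefl _ (hs (a := (l, r)) ⟨h, hk⟩).2.2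
  refine ⟨fun h => ?_, ?_⟩
  · by_cases htriv : l = ⊥ ∧ r = ⊤
    · exact Or.inl htriv
    right
    obtain ⟨m, hm, hmax⟩ := h.exists_argmax
    have hm' : m ∈ Ioo (⊥ : ι) ⊤ := ⟨bot_le.trans_lt hm.1, hm.2.trans_le le_top⟩
    have hl_lt : l ≠ ⊥ → {d ∈ N | l ∈ Ioo d.1 d.2}.ncard < {d ∈ N | m ∈ Ioo d.1 d.2}.ncard :=
      fun hl => (hcount m hm' l ⟨bot_lt_iff_ne_bot.2 hl, h.lt.trans_le le_top⟩).1 (h.2 m hm).1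
    have hr_lt : r ≠ ⊤ → {d ∈ N | r ∈ Ioo d.1 d.2}.ncard < {d ∈ N | m ∈ Ioo d.1 d.2}.ncard :=
      fun hr => (hcount m hm' r ⟨bot_le.trans_lt h.lt, lt_top_iff_ne_top.2 hr⟩).1 (h.2 m hm).2
    -- Otherwise every member around `m` leaves `[l, r]`. Since members do not cross, they all leave
    -- it beyond `l` or all beyond `r`, so that this end is at least as deep as `m`, contrary to its
    -- larger weight.
    have hex : ∃ d ∈ N, m ∈ Ioo d.1 d.2 ∧ l ≤ d.1 ∧ d.2 ≤ r := by
      by_contra! hno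
      by_cases hA : ∀ d ∈ N, m ∈ Ioo d.1 d.2 → d.1 < l
      · by_cases hl : l = ⊥
        · have he : {d ∈ N | m ∈ Ioo d.1 d.2} = ∅ := by
            ext d
            simp only [mem_ofPred_eq, mem_empty_iff_false, iff_false]
            exact fun hd => not_lt_bot (hl ▸ hA d hd.1 hd.2)
          have := hr_lt fun hr => htriv ⟨hl, hr⟩
          rw [he, Set.ncard_empty] at this
          omega
        · refine absurd (hl_lt hl) (not_lt.2 (Set.ncard_le_ncard ?_))
          exact fun d hd => ⟨hd.1, hA d hd.1 hd.2, hm.1.trans hd.2.2⟩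
      · push Not at hA
        obtain ⟨d, hd, hmd, hld⟩ := hA
        have hrd := hno d hd hmd hld
        have hB : ∀ e ∈ N, m ∈ Ioo e.1 e.2 → r < e.2 := by
          intro e he hme
          by_contra! hre
          have hel : e.1 < l := not_le.1 fun hle => absurd (hno e he hme hle) (not_lt.2 hre)
          exact hcross e he d hd (hel.trans_le hld) (hmd.1.trans hme.2) (hre.trans_lt hrd)
        refine absurd (hr_lt (hrd.trans_le le_top).ne) (not_lt.2 (Set.ncard_le_ncard ?_))
        exact fun e he => ⟨he.1, he.2.1.trans hm.2, hB e he.1 he.2⟩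
    obtain ⟨⟨i, j⟩, hd, hmd, hld, hdr⟩ := hex
    have hc := (key i j hd).2 m hmd
    have hi : l = i := hld.eq_of_not_lt fun hlt =>
      absurd (hmax i ⟨hlt, hmd.1.trans hm.2⟩) (not_le.2 hc.1)
    have hj : j = r := hdr.eq_of_not_lt fun hlt =>
      absurd (hmax j ⟨hm.1.trans hmd.2, hlt⟩) (not_le.2 hc.2)
    rwa [hi, ← hj]
  · rintro (⟨rfl, rfl⟩ | h)
    · exact isChord_bot_top hv hι
    · exact key l r h

/-- A set whose sides are chords and which is not cut by chords is the cell of a chord. -/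
lemma Peaked.eq_chordCell [Finite ι] [BoundedOrder ι] {v : ι → α} (hv : Peaked v) {A : Set ι}
    {l r t : ι} (hl : l ∈ A) (hr : r ∈ A) (hA : A ⊆ Icc l r) (ht : t ∈ A) (htl : t ∈ Ioo l r)
    (hadj : ∀ i ∈ A, ∀ j ∈ A, (Ioo i j).Nonempty → (∀ k ∈ Ioo i j, k ∉ A) → IsChord v i j)
    (hcut : ∀ i j, IsChord v i j → A ⊆ Icc i j ∨ Disjoint A (Ioo i j)) :
    A = chordCell v l r := by
  -- The chord around `i` formed by the nearest heavier elements does not cut `A`, so `A` lies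
  -- within it and the inner elements of `A` are at most as heavy as `i`.
  have heq : ∀ i ∈ A, i ∈ Ioo l r → ∀ j ∈ Ioo l r, j ∈ A → v j ≤ v i := by
    intro i hi hil j hjl hj
    obtain ⟨g, g', hg, hig, hle⟩ :=
      hv.exists_isChord (k := i) ⟨bot_le.trans_lt hil.1, hil.2.trans_le le_top⟩
    rcases hcut g g' hg with h | h
    · exact hle j ⟨(h hl).1.trans_lt hjl.1, hjl.2.trans_le (h hr).2⟩
    · exact absurd hig (Set.disjoint_left.1 h hi)
  have hlt : ∀ k ∈ Ioo l r, k ∉ A → ∀ i ∈ A, i ∈ Ioo l r → v k < v i := by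
    intro k hkl hk i hi hil
    obtain ⟨x, hx, y, hy, hlx, hxk, hky, hyr, hgap⟩ := exists_adjacent hk hl hkl.1 hr hkl.2
    have hc := (hadj x hx y hy ⟨k, hxk, hky⟩ hgap).2 k ⟨hxk, hky⟩
    rcases le_or_gt i x with h | h
    · exact hc.1.trans_le (heq i hi hil x ⟨hil.1.trans_le h, hxk.trans hkl.2⟩ hx)
    · have hyi : y ≤ i := not_lt.1 fun hiy => hgap i ⟨h, hiy⟩ hi
      exact hc.2.trans_le (heq i hi hil y ⟨hkl.1.trans hky, hyi.trans_lt hil.2⟩ hy)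
  ext k
  constructor
  · intro hk
    by_cases h₁ : k = l
    · exact Or.inl h₁
    by_cases h₂ : k = r
    · exact Or.inr (Or.inl h₂)
    have hkl : k ∈ Ioo l r := ⟨(hA hk).1.lt_of_ne' h₁, (hA hk).2.lt_of_ne h₂⟩
    refine Or.inr (Or.inr ⟨hkl, fun j hj => ?_⟩)
    by_cases hjA : j ∈ A
    · exact heq k hk hkl j hj hjA
    · exact (hlt j hj hjA k hk hkl).le
  · rintro (rfl | rfl | ⟨hk, hmax⟩)
    · exact hl
    · exact hr
    · by_contra hkA
      exact absurd (hmax t htl) (not_le.2 (hlt k hk hkA t ht htl))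

/-- If the maximum over every interval is unique, there are as many chords as inner elements. -/
lemma Peaked.encard_isChord [Finite ι] [BoundedOrder ι] {v : ι → α} (hv : Peaked v)
    (hinj : ∀ k ∈ Ioo (⊥ : ι) ⊤, ∀ k' ∈ Ioo (⊥ : ι) ⊤, k < k' → v k = v k' →
      ∃ j ∈ Icc k k', v k < v j) :
    {d : ι × ι | IsChord v d.1 d.2}.encard = (Ioo (⊥ : ι) ⊤).encard := by
  -- Every chord is recovered from any maximum strictly inside it, so the map from inner elements to
  -- chords is onto. Two elements with the same chord would be tied maxima, which `hinj` excludes.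
  choose! f g hfg hk hmax using fun (k : ι) (h : k ∈ Ioo (⊥ : ι) ⊤) => hv.exists_isChord h
  have himg : {d : ι × ι | IsChord v d.1 d.2} = (fun k => (f k, g k)) '' Ioo (⊥ : ι) ⊤ := by
    ext ⟨l, r⟩
    constructor
    · intro h
      obtain ⟨k, hkl, hkmax⟩ := IsChord.exists_argmax h
      have hk₀ : k ∈ Ioo (⊥ : ι) ⊤ := ⟨bot_le.trans_lt hkl.1, hkl.2.trans_le le_top⟩
      have h₁ := (hfg k hk₀).2 k (hk k hk₀)
      have h₂ := h.2 k hkl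
      have hkf := hk k hk₀
      refine ⟨k, hk₀, Prod.ext (le_antisymm ?_ ?_) (le_antisymm ?_ ?_)⟩
      · exact not_lt.1 fun hlt => absurd (hkmax _ ⟨hlt, hkf.1.trans hkl.2⟩) (not_le.2 h₁.1)
      · exact not_lt.1 fun hlt =>
          absurd (hmax k hk₀ _ ⟨hlt, hkl.1.trans hkf.2⟩) (not_le.2 h₂.1)
      · exact not_lt.1 fun hlt =>
          absurd (hmax k hk₀ _ ⟨hkf.1.trans hkl.2, hlt⟩) (not_le.2 h₂.2)
      · exact not_lt.1 fun hlt => absurd (hkmax _ ⟨hkl.1.trans hkf.2, hlt⟩) (not_le.2 h₁.2)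
    · rintro ⟨k, hk₀, he⟩
      obtain ⟨rfl, rfl⟩ := Prod.mk.inj he
      exact hfg k hk₀
  have key : ∀ k ∈ Ioo (⊥ : ι) ⊤, ∀ k' ∈ Ioo (⊥ : ι) ⊤, f k = f k' → g k = g k' → ¬ k < k' := by
    intro k hk₀ k' hk₀' h₁ h₂ hlt
    have hk' := hk k' hk₀'
    rw [← h₁, ← h₂] at hk'
    have hm' := hmax k' hk₀'
    rw [← h₁, ← h₂] at hm'
    have he : v k = v k' := le_antisymm (hm' k (hk k hk₀)) (hmax k hk₀ k' hk')
    obtain ⟨j, hj, hlt'⟩ := hinj k hk₀ k' hk₀' hlt he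
    exact absurd (hmax k hk₀ j ⟨(hk k hk₀).1.trans_le hj.1, hj.2.trans_lt hk'.2⟩) (not_le.2 hlt')
  rw [himg, Set.InjOn.encard_image]
  intro k hk₀ k' hk₀' he
  obtain ⟨h₁, h₂⟩ := Prod.mk.inj he
  exact le_antisymm (not_lt.1 (key k' hk₀' k hk₀ h₁.symm h₂.symm))
    (not_lt.1 (key k hk₀ k' hk₀' h₁ h₂))

end Chords

/-! ### Faces of convex hulls -/

section ConvexHull

variable {E : Type*} [AddCommGroup E] [Module ℝ E]

/-- The points with `f ≤ c` that lie in the hull of the face as soon as `f = c` form a convex set: a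
proper convex combination reaches `c` only if both points do. -/
lemma mem_convexHull_face {s : Set E} (f : E →ₗ[ℝ] ℝ) {c : ℝ} (hs : ∀ y ∈ s, f y ≤ c) {x : E}
    (hx : x ∈ convexHull ℝ s) (hfx : f x = c) : x ∈ convexHull ℝ {y ∈ s | f y = c} := by
  have hK : Convex ℝ {x | f x ≤ c ∧ (f x = c → x ∈ convexHull ℝ {y ∈ s | f y = c})} := by
    rintro x ⟨hx, hx'⟩ y ⟨hy, hy'⟩ a b ha hb hab
    have hle : f (a • x + b • y) = a * f x + b * f y := by simp
    refine ⟨?_, fun he => ?_⟩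
    · rw [hle]
      have h₁ := mul_le_mul_of_nonneg_left hx ha
      have h₂ := mul_le_mul_of_nonneg_left hy hb
      have h₃ : a * c + b * c = c := by rw [← add_mul, hab, one_mul]
      linarith
    · rcases ha.eq_or_lt with rfl | ha'
      · obtain rfl : b = 1 := by linarith
        simp only [zero_smul, one_smul, zero_add] at he ⊢
        exact hy' he
      rcases hb.eq_or_lt with rfl | hb'
      · obtain rfl : a = 1 := by linarith
        simp only [zero_smul, one_smul, add_zero] at he ⊢
        exact hx' he
      have h₁ : f x = c := by
        by_contra hne
        have := hx.lt_of_ne hne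
        have : a * f x + b * f y < a * c + b * c :=
          add_lt_add_of_lt_of_le (mul_lt_mul_of_pos_left this ha')
            (mul_le_mul_of_nonneg_left hy hb)
        rw [← add_mul, hab, one_mul, ← hle, he] at this
        exact lt_irrefl _ this
      have h₂ : f y = c := by
        by_contra hne
        have := hy.lt_of_ne hne
        have : a * f x + b * f y < a * c + b * c :=
          add_lt_add_of_le_of_lt (mul_le_mul_of_nonneg_left hx ha)
            (mul_lt_mul_of_pos_left this hb')
        rw [← add_mul, hab, one_mul, ← hle, he] at this
        exact lt_irrefl _ this
      exact convex_convexHull ℝ _ (hx' h₁) (hy' h₂) ha hb hab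
  have hsK : s ⊆ {x | f x ≤ c ∧ (f x = c → x ∈ convexHull ℝ {y ∈ s | f y = c})} :=
    fun y hy => ⟨hs y hy, fun he => subset_convexHull ℝ _ ⟨hy, he⟩⟩
  exact (convexHull_min hsK hK hx).2 hfx

lemma le_of_mem_convexHull {s : Set E} (f : E →ₗ[ℝ] ℝ) {c : ℝ} (hs : ∀ y ∈ s, f y ≤ c) {x : E}
    (hx : x ∈ convexHull ℝ s) : f x ≤ c :=
  convexHull_min (t := {x | f x ≤ c}) hs (convex_halfSpace_le f.isLinear c) hx

/-- The part of a convex hull on one side of a hyperplane, if the hull of the points on that side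
contains the section by the hyperplane. -/
lemma mem_convexHull_of_le {U V : Set E} (f : E →ₗ[ℝ] ℝ) {c : ℝ} (hU : ∀ y ∈ U, f y ≤ c)
    (hV : ∀ y ∈ V, c ≤ f y) (hUne : U.Nonempty)
    (hline : ∀ x ∈ convexHull ℝ (U ∪ V), f x = c → x ∈ convexHull ℝ U) {x : E}
    (hx : x ∈ convexHull ℝ (U ∪ V)) (hfx : f x ≤ c) : x ∈ convexHull ℝ U := by
  rcases V.eq_empty_or_nonempty with rfl | hVne
  · simpa using hx
  have hx₀ := hx
  rw [convexHull_union hUne hVne, mem_convexJoin] at hx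
  obtain ⟨y, hy, z, hz, a, s, ha, hs, has, rfl⟩ := hx
  have hfy : f y ≤ c := le_of_mem_convexHull f hU hy
  have hfz : c ≤ f z := by
    have := le_of_mem_convexHull (-f) (c := -c) (fun y hy => by simpa using hV y hy) hz
    simpa using this
  have hfx' : a * f y + s * f z ≤ c := by simpa using hfx
  obtain rfl : a = 1 - s := by linarith
  rcases hs.eq_or_lt with rfl | hs'
  · simpa using hy
  rcases hfy.eq_or_lt with hyc | hyc
  · have : f z = c := by
      refine le_antisymm ?_ hfz
      rw [hyc] at hfx'
      nlinarith
    exact hline _ hx₀ (by simp only [map_add, map_smul, smul_eq_mul, hyc, this]; ring)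
  have hpos : 0 < f z - f y := by linarith
  -- The segment from `y` to `z` meets the hyperplane at parameter `q`. As `s ≤ q`, the given point
  -- lies between `y` and this crossing point, and both are in the hull of `U`.
  set q : ℝ := (c - f y) / (f z - f y) with hq
  have hq0 : 0 < q := div_pos (by linarith) hpos
  have hq1 : q ≤ 1 := (div_le_one hpos).2 (by linarith)
  have hqe : q * (f z - f y) = c - f y := div_mul_cancel₀ _ hpos.ne'
  have hsq : s ≤ q := by
    rw [hq, le_div_iff₀ hpos]
    linarith
  have hmono := fun {A B : Set E} (h : A ⊆ B) => convexHull_mono (𝕜 := ℝ) h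
  have hu : (1 - q) • y + q • z ∈ convexHull ℝ U := by
    refine hline _ ?_ ?_
    · exact convex_convexHull ℝ _ (hmono Set.subset_union_left hy)
        (hmono Set.subset_union_right hz) (by linarith) hq0.le (by ring)
    · simp only [map_add, map_smul, smul_eq_mul]
      linarith
  have := convex_convexHull ℝ U hy hu (a := 1 - s / q) (b := s / q)
    (by rw [sub_nonneg]; exact (div_le_one hq0).2 hsq) (by positivity) (by ring)
  convert this using 1
  rw [smul_add, ← add_assoc, smul_smul, smul_smul, ← add_smul]
  congr 2
  · field_simp
    ring
  · field_simp

end ConvexHull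

/-! ### Convex polygons -/

section Polygon

open Set

/-- The linear functional whose level lines are parallel to `b - a`. -/
noncomputable def crossDual (a b : Plane) : StrongDual ℝ Plane :=
  (b 0 - a 0) • ContinuousLinearMap.proj (R := ℝ) (φ := fun _ : Fin 2 => ℝ) 1 -
    (b 1 - a 1) • ContinuousLinearMap.proj (R := ℝ) (φ := fun _ : Fin 2 => ℝ) 0

/-- Positive to the left, and negative to the right of the line from `a` to `b`. -/
noncomputable def side (a b x : Plane) : ℝ := crossDual a b x - crossDual a b a

lemma crossDual_apply (a b x : Plane) :
    crossDual a b x = (b 0 - a 0) * x 1 - (b 1 - a 1) * x 0 := by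
  simp [crossDual]

lemma side_eq (a b x : Plane) :
    side a b x = (b 0 - a 0) * (x 1 - a 1) - (b 1 - a 1) * (x 0 - a 0) := by
  simp only [side, crossDual_apply]
  ring

lemma side_left (a b : Plane) : side a b a = 0 := by simp [side]

lemma side_right (a b : Plane) : side a b b = 0 := by
  rw [side_eq]
  ring

lemma crossDual_left_eq_right (a b : Plane) : crossDual a b b = crossDual a b a :=
  sub_eq_zero.1 (side_right a b)

variable {n : ℕ} {p : Fin (n + 3) → Plane}

lemma IsConvexPolygon.side_pos_of_lt (hp : IsConvexPolygon p) {i j k : Fin (n + 3)} (hij : i < j)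
    (hk : k < i) : 0 < side (p i) (p j) (p k) := by
  have := hp k i j hk hij
  rw [side_eq]
  linarith

lemma IsConvexPolygon.side_pos_of_gt (hp : IsConvexPolygon p) {i j k : Fin (n + 3)} (hij : i < j)
    (hk : j < k) : 0 < side (p i) (p j) (p k) := by
  have := hp i j k hij hk
  rw [side_eq]
  linarith

lemma IsConvexPolygon.side_neg (hp : IsConvexPolygon p) {i j k : Fin (n + 3)}
    (hk : k ∈ Ioo i j) : side (p i) (p j) (p k) < 0 := by
  have := hp i k j hk.1 hk.2
  rw [side_eq]
  linarith

lemma IsConvexPolygon.side_nonpos_iff (hp : IsConvexPolygon p) {i j k : Fin (n + 3)} (hij : i < j) :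
    side (p i) (p j) (p k) ≤ 0 ↔ k ∈ Icc i j := by
  constructor
  · intro h
    exact ⟨not_lt.1 fun h' => (hp.side_pos_of_lt hij h').not_ge h,
      not_lt.1 fun h' => (hp.side_pos_of_gt hij h').not_ge h⟩
  · rintro ⟨h₁, h₂⟩
    rcases h₁.eq_or_lt with rfl | h₁
    · exact (side_left _ _).le
    rcases h₂.eq_or_lt with rfl | h₂
    · exact (side_right _ _).le
    exact (hp.side_neg ⟨h₁, h₂⟩).le

lemma IsConvexPolygon.side_nonneg_iff (hp : IsConvexPolygon p) {i j k : Fin (n + 3)} (hij : i < j) :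
    0 ≤ side (p i) (p j) (p k) ↔ k ∉ Ioo i j := by
  constructor
  · exact fun h hk => (hp.side_neg hk).not_ge h
  · intro h
    rcases lt_trichotomy k i with h₁ | rfl | h₁
    · exact (hp.side_pos_of_lt hij h₁).le
    · exact (side_left _ _).ge
    rcases lt_trichotomy k j with h₂ | rfl | h₂
    · exact absurd ⟨h₁, h₂⟩ h
    · exact (side_right _ _).ge
    · exact (hp.side_pos_of_gt hij h₂).le

lemma IsConvexPolygon.side_eq_zero_iff (hp : IsConvexPolygon p) {i j k : Fin (n + 3)}
    (hij : i < j) : side (p i) (p j) (p k) = 0 ↔ k = i ∨ k = j := by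
  rw [le_antisymm_iff, hp.side_nonpos_iff hij, hp.side_nonneg_iff hij]
  constructor
  · rintro ⟨h, h'⟩
    by_contra! hne
    exact h' ⟨h.1.lt_of_ne' hne.1, h.2.lt_of_ne hne.2⟩
  · rintro (rfl | rfl)
    · exact ⟨⟨le_rfl, hij.le⟩, fun h => lt_irrefl _ h.1⟩
    · exact ⟨⟨hij.le, le_rfl⟩, fun h => lt_irrefl _ h.2⟩

/-- Every vertex of a convex polygon is the unique maximum of a linear functional. -/
lemma IsConvexPolygon.exists_exposing (hp : IsConvexPolygon p) (i : Fin (n + 3)) :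
    ∃ f : StrongDual ℝ Plane, ∀ k, k ≠ i → f (p k) < f (p i) := by
  -- Add the side functions of the two edges at `i` and change the sign. The edge between the first
  -- and the last vertex needs the factor `-1`, since the polygon lies to its right.
  have main : ∀ a b c d : Fin (n + 3), ∀ s t : ℝ, s * side (p a) (p b) (p i) = 0 →
      t * side (p c) (p d) (p i) = 0 →
      (∀ k, k ≠ i → 0 < s * side (p a) (p b) (p k) + t * side (p c) (p d) (p k)) →
      ∃ f : StrongDual ℝ Plane, ∀ k, k ≠ i → f (p k) < f (p i) := by
    intro a b c d s t h₁ h₂ h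
    refine ⟨-(s • crossDual (p a) (p b) + t • crossDual (p c) (p d)), fun k hk => ?_⟩
    have := h k hk
    simp only [side] at h₁ h₂ this
    simp only [neg_apply, add_apply, smul_apply, smul_eq_mul]
    linarith
  rcases Fin.eq_zero_or_eq_succ i with rfl | ⟨i', rfl⟩
  · have h01 : (0 : Fin (n + 3)) < 1 := by simp
    have h0l : (0 : Fin (n + 3)) < Fin.last _ := Fin.last_pos
    refine main 0 1 0 (Fin.last _) 1 (-1) (by simp [side_left]) (by simp [side_left]) ?_
    intro k hk
    have hk' : 0 < k := Fin.pos_iff_ne_zero.2 hk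
    have h₁ := (hp.side_nonneg_iff (k := k) h01).2 fun h => hk (Fin.lt_one_iff k |>.1 h.2)
    have h₂ := (hp.side_nonpos_iff (k := k) h0l).2 ⟨hk'.le, Fin.le_last _⟩
    rcases eq_or_ne k 1 with rfl | hk1
    · have := hp.side_neg (i := 0) (j := Fin.last _) (k := (1 : Fin (n + 3)))
        ⟨h01, by simp [Fin.lt_def]⟩
      linarith
    · have : side (p 0) (p 1) (p k) ≠ 0 := fun h =>
        ((hp.side_eq_zero_iff h01).1 h).elim hk hk1
      have := h₁.lt_of_ne' this
      linarith
  · rcases Fin.eq_castSucc_or_eq_last i' with ⟨j, rfl⟩ | rfl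
    · have hlt₁ : j.castSucc.castSucc < j.castSucc.succ := Fin.castSucc_lt_succ
      have hlt₂ : j.castSucc.succ < j.succ.succ := by simp [Fin.lt_def]
      refine main j.castSucc.castSucc j.castSucc.succ j.castSucc.succ j.succ.succ 1 1
        (by simp [side_right]) (by simp [side_left]) fun k hk => ?_
      have h₁ := (hp.side_nonneg_iff (k := k) hlt₁).2 (by simp [Fin.lt_def])
      have h₂ := (hp.side_nonneg_iff (k := k) hlt₂).2 (by simp [Fin.lt_def])
      have : side (p j.castSucc.castSucc) (p j.castSucc.succ) (p k) ≠ 0 ∨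
          side (p j.castSucc.succ) (p j.succ.succ) (p k) ≠ 0 := by
        by_contra! h
        have e₁ := ((hp.side_eq_zero_iff hlt₁).1 h.1).resolve_right hk
        have e₂ := ((hp.side_eq_zero_iff hlt₂).1 h.2).resolve_left hk
        rw [e₁] at e₂
        simp only [Fin.ext_iff, Fin.val_castSucc, Fin.val_succ] at e₂
        omega
      rcases this with h | h
      · have := h₁.lt_of_ne' h
        linarith
      · have := h₂.lt_of_ne' h
        linarith
    · have hlt₁ : (Fin.last (n + 1)).castSucc < (Fin.last (n + 1)).succ := Fin.castSucc_lt_succ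
      have hlt₂ : 0 < (Fin.last (n + 1)).succ := Fin.succ_pos _
      refine main (Fin.last (n + 1)).castSucc (Fin.last (n + 1)).succ 0 (Fin.last (n + 1)).succ
        1 (-1) (by simp [side_right]) (by simp [side_right]) fun k hk => ?_
      have h₁ := (hp.side_nonneg_iff (k := k) hlt₁).2 (by simp [Fin.lt_def])
      have h₂ := (hp.side_nonpos_iff (k := k) hlt₂).2 ⟨Fin.zero_le _, Fin.le_last _⟩
      rcases eq_or_ne k (Fin.last (n + 1)).castSucc with rfl | hk1
      · have := hp.side_neg (i := 0) (j := (Fin.last (n + 1)).succ)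
          (k := (Fin.last (n + 1)).castSucc) ⟨by simp [Fin.lt_def], hlt₁⟩
        linarith
      · have : side (p (Fin.last (n + 1)).castSucc) (p (Fin.last (n + 1)).succ) (p k) ≠ 0 :=
          fun h => ((hp.side_eq_zero_iff hlt₁).1 h).elim hk1 hk
        have := h₁.lt_of_ne' this
        linarith

lemma IsConvexPolygon.injective (hp : IsConvexPolygon p) : Function.Injective p := by
  intro i j hij
  by_contra hne
  obtain ⟨f, hf⟩ := hp.exists_exposing j
  exact (hf i hne).ne (by rw [hij])

lemma IsConvexPolygon.mem_convexHull_iff (hp : IsConvexPolygon p) {A : Set (Fin (n + 3))}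
    {i : Fin (n + 3)} : p i ∈ convexHull ℝ (p '' A) ↔ i ∈ A := by
  refine ⟨fun h => ?_, fun h => subset_convexHull ℝ _ ⟨i, h, rfl⟩⟩
  by_contra hi
  obtain ⟨f, hf⟩ := hp.exists_exposing i
  have := mem_convexHull_face f.toLinearMap (c := f (p i)) (s := p '' A) (by
    rintro _ ⟨k, hk, rfl⟩
    exact (hf k fun e => hi (e ▸ hk)).le) h rfl
  have he : {y ∈ p '' A | f.toLinearMap y = f (p i)} = ∅ := by
    ext y
    simp only [mem_ofPred_eq, mem_empty_iff_false, iff_false]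
    rintro ⟨⟨k, hk, rfl⟩, h⟩
    exact (hf k fun e => hi (e ▸ hk)).ne h
  rw [he, convexHull_empty] at this
  exact this

/-- This reduces comparison of cells to comparison of index sets. -/
lemma IsConvexPolygon.convexHull_subset_iff (hp : IsConvexPolygon p) {A B : Set (Fin (n + 3))} :
    convexHull ℝ (p '' A) ⊆ convexHull ℝ (p '' B) ↔ A ⊆ B := by
  refine ⟨fun h i hi => ?_, fun h => convexHull_mono (image_mono h)⟩
  exact hp.mem_convexHull_iff.1 (h (hp.mem_convexHull_iff.2 hi))

lemma convexHull_image_subset (A : Set (Fin (n + 3))) :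
    convexHull ℝ (p '' A) ⊆ convexHull ℝ (range p) :=
  convexHull_mono (image_subset_range _ _)

lemma side_nonneg_of_mem {a b : Plane} {s : Set Plane} (hs : ∀ y ∈ s, 0 ≤ side a b y) {x : Plane}
    (hx : x ∈ convexHull ℝ s) : 0 ≤ side a b x := by
  have := le_of_mem_convexHull (-crossDual a b).toLinearMap (c := -crossDual a b a)
    (fun y hy => by simpa [side] using hs y hy) hx
  simpa [side] using this

lemma side_nonpos_of_mem {a b : Plane} {s : Set Plane} (hs : ∀ y ∈ s, side a b y ≤ 0) {x : Plane}
    (hx : x ∈ convexHull ℝ s) : side a b x ≤ 0 := by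
  have := le_of_mem_convexHull (crossDual a b).toLinearMap (c := crossDual a b a)
    (fun y hy => by simpa [side] using hs y hy) hx
  simpa [side] using this

lemma IsConvexPolygon.side_nonpos (hp : IsConvexPolygon p) {A : Set (Fin (n + 3))}
    {i j : Fin (n + 3)} (hij : i < j) (hA : A ⊆ Icc i j) {x : Plane}
    (hx : x ∈ convexHull ℝ (p '' A)) : side (p i) (p j) x ≤ 0 := by
  refine side_nonpos_of_mem ?_ hx
  rintro _ ⟨k, hk, rfl⟩
  exact (hp.side_nonpos_iff hij).2 (hA hk)

lemma IsConvexPolygon.side_nonneg (hp : IsConvexPolygon p) {A : Set (Fin (n + 3))}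
    {i j : Fin (n + 3)} (hij : i < j) (hA : Disjoint A (Ioo i j)) {x : Plane}
    (hx : x ∈ convexHull ℝ (p '' A)) : 0 ≤ side (p i) (p j) x := by
  refine side_nonneg_of_mem ?_ hx
  rintro _ ⟨k, hk, rfl⟩
  exact (hp.side_nonneg_iff hij).2 (disjoint_left.1 hA hk)

lemma exists_smul_of_side_eq_zero {a b x : Plane} (hab : a ≠ b) (h : side a b x = 0) :
    ∃ t : ℝ, x = a + t • (b - a) := by
  rw [side_eq] at h
  by_cases h0 : b 0 - a 0 = 0
  · have h1 : b 1 - a 1 ≠ 0 := by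
      intro h1
      apply hab
      ext k
      fin_cases k
      · simpa using (sub_eq_zero.1 h0).symm
      · simpa using (sub_eq_zero.1 h1).symm
    refine ⟨(x 1 - a 1) / (b 1 - a 1), ?_⟩
    ext k
    fin_cases k
    · have : (b 1 - a 1) * (x 0 - a 0) = 0 := by rw [h0] at h; linarith
      have := (mul_eq_zero.1 this).resolve_left h1
      simp [h0]
      linarith
    · simp
      field_simp
      ring
  · refine ⟨(x 0 - a 0) / (b 0 - a 0), ?_⟩
    ext k
    fin_cases k
    · simp
      field_simp
      ring
    · simp
      field_simp
      linarith

/-- On the line, the functionals that expose `p i` and `p j` bound the parameter `t` by `0 ≤ t` and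
`t ≤ 1`. -/
lemma IsConvexPolygon.mem_segment_of_side_eq_zero (hp : IsConvexPolygon p) {i j : Fin (n + 3)}
    (hij : i ≠ j) {x : Plane} (hx : x ∈ convexHull ℝ (range p))
    (h : side (p i) (p j) x = 0) : x ∈ segment ℝ (p i) (p j) := by
  obtain ⟨t, rfl⟩ := exists_smul_of_side_eq_zero (fun e => hij (hp.injective e)) h
  have key : ∀ k : Fin (n + 3), ∃ f : StrongDual ℝ Plane, (∀ k', k' ≠ k → f (p k') < f (p k)) ∧
      f (p i + t • (p j - p i)) ≤ f (p k) := by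
    intro k
    obtain ⟨f, hf⟩ := hp.exists_exposing k
    refine ⟨f, hf, le_of_mem_convexHull f.toLinearMap ?_ hx⟩
    rintro _ ⟨k', rfl⟩
    rcases eq_or_ne k' k with rfl | hk
    · exact le_rfl
    · exact (hf k' hk).le
  obtain ⟨f, hf, hfx⟩ := key i
  obtain ⟨g, hg, hgx⟩ := key j
  have hf' := hf j hij.symm
  have hg' := hg i hij
  simp only [map_add, map_smul, map_sub, smul_eq_mul] at hfx hgx
  rw [segment_eq_image']
  exact ⟨t, ⟨by nlinarith, by nlinarith⟩, rfl⟩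

lemma IsConvexPolygon.mem_pair_of_side_eq_zero (hp : IsConvexPolygon p) {i j : Fin (n + 3)}
    (hij : i ≠ j) {x : Plane} (hx : x ∈ convexHull ℝ (range p))
    (h : side (p i) (p j) x = 0) {A : Set (Fin (n + 3))} (hi : i ∈ A) (hj : j ∈ A) :
    x ∈ convexHull ℝ (p '' A) :=
  (convex_convexHull ℝ _).segment_subset (hp.mem_convexHull_iff.2 hi) (hp.mem_convexHull_iff.2 hj)
    (hp.mem_segment_of_side_eq_zero hij hx h)

/-- A chord splits a polygon into two: the part to the right. -/
lemma IsConvexPolygon.mem_convexHull_inter_Icc (hp : IsConvexPolygon p) {A : Set (Fin (n + 3))}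
    {i j : Fin (n + 3)} (hij : i < j) (hi : i ∈ A) (hj : j ∈ A) {x : Plane}
    (hx : x ∈ convexHull ℝ (p '' A)) (h : side (p i) (p j) x ≤ 0) :
    x ∈ convexHull ℝ (p '' (A ∩ Icc i j)) := by
  have hU : A = (A ∩ Icc i j) ∪ (A \ Ioo i j) := by
    ext k
    constructor
    · intro hk
      by_cases h : k ∈ Icc i j
      · exact Or.inl ⟨hk, h⟩
      · exact Or.inr ⟨hk, fun h' => h ⟨h'.1.le, h'.2.le⟩⟩
    · rintro (h | h) <;> exact h.1
  have himg : p '' A = p '' (A ∩ Icc i j) ∪ p '' (A \ Ioo i j) := by rw [← image_union, ← hU]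
  rw [himg] at hx
  refine mem_convexHull_of_le (U := p '' (A ∩ Icc i j)) (crossDual (p i) (p j)).toLinearMap
    (c := crossDual (p i) (p j) (p i))
    ?_ ?_ ⟨p i, i, ⟨hi, le_rfl, hij.le⟩, rfl⟩ ?_ hx (by simpa [side] using h)
  · rintro _ ⟨k, hk, rfl⟩
    simpa [side] using (hp.side_nonpos_iff hij).2 hk.2
  · rintro _ ⟨k, hk, rfl⟩
    simpa [side] using (hp.side_nonneg_iff hij).2 hk.2
  · intro y hy hy'
    rw [← himg] at hy
    exact hp.mem_pair_of_side_eq_zero hij.ne (convexHull_image_subset A hy)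
      (by simpa [side, sub_eq_zero] using hy') ⟨hi, le_rfl, hij.le⟩ ⟨hj, hij.le, le_rfl⟩

/-- A chord splits a polygon into two: the part to the left. -/
lemma IsConvexPolygon.mem_convexHull_diff_Ioo (hp : IsConvexPolygon p) {A : Set (Fin (n + 3))}
    {i j : Fin (n + 3)} (hij : i < j) (hi : i ∈ A) (hj : j ∈ A) {x : Plane}
    (hx : x ∈ convexHull ℝ (p '' A)) (h : 0 ≤ side (p i) (p j) x) :
    x ∈ convexHull ℝ (p '' (A \ Ioo i j)) := by
  have hU : A = (A \ Ioo i j) ∪ (A ∩ Icc i j) := by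
    ext k
    constructor
    · intro hk
      by_cases h : k ∈ Icc i j
      · exact Or.inr ⟨hk, h⟩
      · exact Or.inl ⟨hk, fun h' => h ⟨h'.1.le, h'.2.le⟩⟩
    · rintro (h | h) <;> exact h.1
  have himg : p '' A = p '' (A \ Ioo i j) ∪ p '' (A ∩ Icc i j) := by rw [← image_union, ← hU]
  have hi' : i ∈ A \ Ioo i j := ⟨hi, fun h => lt_irrefl _ h.1⟩
  have hj' : j ∈ A \ Ioo i j := ⟨hj, fun h => lt_irrefl _ h.2⟩
  rw [himg] at hx
  refine mem_convexHull_of_le (U := p '' (A \ Ioo i j)) (-crossDual (p i) (p j)).toLinearMap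
    (c := -crossDual (p i) (p j) (p i)) ?_ ?_ ⟨p i, i, hi', rfl⟩ ?_ hx (by simpa [side] using h)
  · rintro _ ⟨k, hk, rfl⟩
    simpa [side] using (hp.side_nonneg_iff hij).2 hk.2
  · rintro _ ⟨k, hk, rfl⟩
    simpa [side] using (hp.side_nonpos_iff hij).2 hk.2
  · intro y hy hy'
    rw [← himg] at hy
    exact hp.mem_pair_of_side_eq_zero hij.ne (convexHull_image_subset A hy)
      (by simpa [side, sub_eq_zero] using hy') hi' hj'

/-- A polygon is the intersection of the half-planes given by its edges. -/
lemma IsConvexPolygon.mem_convexHull_of_side (hp : IsConvexPolygon p) {A : Set (Fin (n + 3))}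
    {l r : Fin (n + 3)} (hlr : l < r) (hl : l ∈ A) (hr : r ∈ A) {x : Plane}
    (hx : x ∈ convexHull ℝ (range p)) (hx' : side (p l) (p r) x ≤ 0)
    (h : ∀ i ∈ A, ∀ j ∈ A, i < j → (∀ k ∈ Ioo i j, k ∉ A) → 0 ≤ side (p i) (p j) x) :
    x ∈ convexHull ℝ (p '' A) := by
  have hx₀ : x ∈ convexHull ℝ (p '' Icc l r) := by
    have := hp.mem_convexHull_inter_Icc hlr (mem_univ l) (mem_univ r)
      (by rwa [image_univ]) hx'
    rwa [univ_inter] at this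
  -- Start from all vertices between `l` and `r` and discard as many as possible outside `A`. A
  -- remaining one lies behind a side of `A`; since `x` is on the other side of it, all vertices
  -- behind that side can be discarded.
  obtain ⟨B, hB⟩ := Set.Finite.exists_minimal
    (s := {B : Set (Fin (n + 3)) | x ∈ convexHull ℝ (p '' B) ∧ B ⊆ A ∪ Icc l r ∧ A ⊆ B})
    (Set.toFinite _) ⟨A ∪ Icc l r, convexHull_mono (image_mono subset_union_right) hx₀,
      Subset.rfl, subset_union_left⟩
  refine convexHull_mono (image_mono fun b hb => by_contra fun hbA => ?_) hB.prop.1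
  have hbl := (hB.prop.2.1 hb).resolve_left hbA
  have hne : l ≠ b := fun e => hbA (e ▸ hl)
  have hne' : b ≠ r := fun e => hbA (e ▸ hr)
  obtain ⟨i, hi, j, hj, -, hib, hbj, -, hgap⟩ :=
    exists_adjacent hbA hl (hbl.1.lt_of_ne hne) hr (hbl.2.lt_of_ne hne')
  have := hp.mem_convexHull_diff_Ioo (hib.trans hbj) (hB.prop.2.2 hi) (hB.prop.2.2 hj) hB.prop.1
    (h i hi j hj (hib.trans hbj) hgap)
  exact (hB.2 (y := B \ Ioo i j) ⟨this, sdiff_subset.trans hB.prop.2.1, fun k hk =>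
    ⟨hB.prop.2.2 hk, fun hk' => hgap k hk' hk⟩⟩ sdiff_subset hb).2 ⟨hib, hbj⟩

end Polygon

/-! ### Interiors -/

section Interior

open Set

/-- An inner point is a local maximum of `l`, and the derivative of `l` is `l` itself. -/
lemma StrongDual.eq_zero_of_isMax_interior {E : Type*} [NormedAddCommGroup E] [NormedSpace ℝ E]
    {l : StrongDual ℝ E} {C : Set E} (hC : (interior C).Nonempty)
    (h : ∀ x ∈ C, ∀ y ∈ C, l y ≤ l x) : l = 0 := by
  obtain ⟨x, hx⟩ := hC
  refine IsLocalMax.hasFDerivAt_eq_zero (f := l) (a := x) ?_ l.hasFDerivAt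
  filter_upwards [mem_interior_iff_mem_nhds.1 hx] with y hy
  exact h x (interior_subset hx) y hy

/-- A functional that exposes a set with inner points is constant on it, hence zero, and zero
exposes everything. This is why overlapping cells of a subdivision coincide. -/
lemma IsExposed.eq_of_interior_nonempty {E : Type*} [NormedAddCommGroup E] [NormedSpace ℝ E]
    {C F : Set E} (h : IsExposed ℝ C F) (hF : (interior F).Nonempty) : F = C := by
  obtain ⟨l, hl⟩ := h (hF.mono interior_subset)
  have hmem : ∀ {x}, x ∈ F ↔ x ∈ C ∧ ∀ y ∈ C, l y ≤ l x := fun {x} => by rw [hl]; rfl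
  have : l = 0 := StrongDual.eq_zero_of_isMax_interior hF fun x hx y hy =>
    (hmem.1 hx).2 y (hmem.1 hy).1
  subst this
  ext x
  simp [hmem]

/-- If finitely many closed sets cover a closed set with inner points, then one of them overlaps
it. -/
lemma exists_interior_inter_nonempty {X : Type*} [TopologicalSpace X] {𝒞 : Set (Set X)}
    (hfin : 𝒞.Finite) (hcl : ∀ C ∈ 𝒞, IsClosed C) {K : Set X} (hK : IsClosed K)
    (hne : (interior K).Nonempty) (hcov : K ⊆ ⋃₀ 𝒞) : ∃ C ∈ 𝒞, (interior (K ∩ C)).Nonempty := by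
  by_contra! hno
  have key : interior (K ∩ ⋃₀ 𝒞) = ∅ := by
    clear hcov
    induction 𝒞, hfin using Set.Finite.induction_on with
    | empty => simp
    | @insert C 𝒞 _ _ ih =>
      rw [sUnion_insert, inter_union_distrib_left, interior_union_isClosed_of_interior_empty
        (hK.inter (hcl C (mem_insert _ _)))]
      · exact hno C (mem_insert _ _)
      · exact ih (fun D hD => hcl D (mem_insert_of_mem _ hD))
          fun D hD => hno D (mem_insert_of_mem _ hD)
  rw [inter_eq_self_of_subset_left hcov] at key
  exact hne.ne_empty key

lemma crossDual_ne_zero {a b : Plane} (hab : a ≠ b) : crossDual a b ≠ 0 := by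
  intro h
  apply hab
  have h₁ : crossDual a b (Pi.single 1 1) = 0 := by rw [h]; rfl
  have h₂ : crossDual a b (Pi.single 0 1) = 0 := by rw [h]; rfl
  rw [crossDual_apply] at h₁ h₂
  simp only [Pi.single_eq_same, ne_eq, zero_ne_one, one_ne_zero, not_false_eq_true,
    Pi.single_eq_of_ne] at h₁ h₂
  ext k
  fin_cases k
  · simp
    linarith
  · simp
    linarith

lemma interior_eq_empty_of_side {a b : Plane} (hab : a ≠ b) {C : Set Plane}
    (hC : ∀ x ∈ C, side a b x = 0) : ¬ (interior C).Nonempty := fun h =>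
  crossDual_ne_zero hab (StrongDual.eq_zero_of_isMax_interior h fun x hx y hy => by
    have h₁ := hC x hx
    have h₂ := hC y hy
    simp only [side] at h₁ h₂
    linarith)

lemma continuous_side (a b : Plane) : Continuous (side a b) := by
  unfold side
  fun_prop

variable {n : ℕ} {p : Fin (n + 3) → Plane}

lemma IsConvexPolygon.interior_nonempty (hp : IsConvexPolygon p) {A : Set (Fin (n + 3))}
    {i j k : Fin (n + 3)} (hi : i ∈ A) (hj : j ∈ A) (hk : k ∈ A) (hij : i < j) (hjk : j < k) :
    (interior (convexHull ℝ (p '' A))).Nonempty := by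
  have hD := hp i j k hij hjk
  set D := (p j 0 - p i 0) * (p k 1 - p i 1) - (p j 1 - p i 1) * (p k 0 - p i 0) with hD_def
  -- The open triangle. The three side functions divided by their sum `D` are the barycentric
  -- coordinates; the inner point below is the centroid.
  set U : Set Plane := {x | 0 < side (p j) (p k) x} ∩ {x | 0 < side (p k) (p i) x} ∩
    {x | 0 < side (p i) (p j) x} with hU
  have hUo : IsOpen U := by
    have := fun a b => isOpen_lt (continuous_const (y := (0 : ℝ))) (continuous_side a b)
    exact ((this _ _).inter (this _ _)).inter (this _ _)
  have hUsub : U ⊆ convexHull ℝ (p '' A) := by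
    rintro x ⟨⟨h₁, h₂⟩, h₃⟩
    have hsum : side (p j) (p k) x + side (p k) (p i) x + side (p i) (p j) x = D := by
      simp only [side_eq, hD_def]
      ring
    have hx : x = (side (p j) (p k) x / D) • p i + (side (p k) (p i) x / D) • p j +
        (side (p i) (p j) x / D) • p k := by
      ext c
      have h0 : D * x 0 = side (p j) (p k) x * p i 0 + side (p k) (p i) x * p j 0 +
          side (p i) (p j) x * p k 0 := by
        simp only [side_eq, hD_def]
        ring
      have h1 : D * x 1 = side (p j) (p k) x * p i 1 + side (p k) (p i) x * p j 1 +
          side (p i) (p j) x * p k 1 := by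
        simp only [side_eq, hD_def]
        ring
      fin_cases c
      · simp only [Fin.zero_eta, Pi.add_apply, Pi.smul_apply, smul_eq_mul]
        field_simp
        linarith
      · simp only [Fin.mk_one, Pi.add_apply, Pi.smul_apply, smul_eq_mul]
        field_simp
        linarith
    have hmem : ∀ c ∈ A, p c ∈ convexHull ℝ (p '' A) := fun c hc =>
      subset_convexHull ℝ _ ⟨c, hc, rfl⟩
    have hconv := (convex_convexHull ℝ (p '' A)).sum_mem (t := (Finset.univ : Finset (Fin 3)))
      (w := ![side (p j) (p k) x / D, side (p k) (p i) x / D, side (p i) (p j) x / D])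
      (z := ![p i, p j, p k]) (by
        intro c _
        have h₁ := div_pos h₁ hD
        have h₂ := div_pos h₂ hD
        have h₃ := div_pos h₃ hD
        fin_cases c
        · exact h₁.le
        · exact h₂.le
        · exact h₃.le) (by
        simp only [Fin.sum_univ_three, Matrix.cons_val]
        rw [← add_div, ← add_div, hsum, div_self hD.ne']) (by
        intro c _
        fin_cases c
        · exact hmem i hi
        · exact hmem j hj
        · exact hmem k hk)
    rw [hx]
    simpa only [Fin.sum_univ_three, Matrix.cons_val] using hconv
  refine ⟨fun c => (p i c + p j c + p k c) / 3, interior_maximal hUsub hUo ⟨⟨?_, ?_⟩, ?_⟩⟩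
  all_goals
    simp only [mem_ofPred_eq, side_eq]
    linarith

lemma isClosed_polygon (A : Set (Fin (n + 3))) : IsClosed (convexHull ℝ (p '' A)) :=
  (Set.Finite.isCompact_convexHull ℝ (Set.toFinite (p '' A))).isClosed

/-- Without a third vertex the hull would lie on a line and have no inner points. -/
lemma IsConvexPolygon.exists_mem_Ioo (hp : IsConvexPolygon p) {A : Set (Fin (n + 3))}
    (hA : (interior (convexHull ℝ (p '' A))).Nonempty) :
    ∃ l ∈ A, ∃ r ∈ A, A ⊆ Icc l r ∧ ∃ t ∈ A, t ∈ Ioo l r := by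
  have hne : A.Nonempty := by
    rw [nonempty_iff_ne_empty]
    rintro rfl
    simp at hA
  obtain ⟨l, hl, hl'⟩ := Set.exists_min_image A id (Set.toFinite _) hne
  obtain ⟨r, hr, hr'⟩ := Set.exists_max_image A id (Set.toFinite _) hne
  refine ⟨l, hl, r, hr, fun k hk => ⟨hl' k hk, hr' k hk⟩, ?_⟩
  by_contra! hno
  have hsub : ∀ k ∈ A, k = l ∨ k = r := by
    intro k hk
    by_contra! h
    exact hno k hk ⟨(hl' k hk).lt_of_ne' h.1, (hr' k hk).lt_of_ne h.2⟩
  obtain ⟨m, hm⟩ : ∃ m, m ≠ l ∧ A ⊆ {l, m} := by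
    by_cases h : r = l
    · obtain ⟨m, hm⟩ := exists_ne l
      exact ⟨m, hm, fun k hk => Or.inl ((hsub k hk).elim id fun e => e.trans h)⟩
    · exact ⟨r, h, fun k hk => hsub k hk⟩
  refine interior_eq_empty_of_side (fun e => hm.1 (hp.injective e.symm)) (a := p l) (b := p m)
    (fun x hx => ?_) hA
  have hz : ∀ y ∈ p '' A, side (p l) (p m) y = 0 := by
    rintro _ ⟨k, hk, rfl⟩
    rcases hm.2 hk with rfl | h
    · exact side_left _ _
    · rw [mem_singleton_iff.1 h]
      exact side_right _ _
  exact le_antisymm (side_nonpos_of_mem (fun y hy => (hz y hy).le) hx)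
    (side_nonneg_of_mem (fun y hy => (hz y hy).ge) hx)

lemma IsConvexPolygon.inter_not_overlap (hp : IsConvexPolygon p) {A B : Set (Fin (n + 3))}
    {i j : Fin (n + 3)} (hij : i < j) (hA : A ⊆ Icc i j) (hB : Disjoint B (Ioo i j)) :
    ¬ (interior (convexHull ℝ (p '' A) ∩ convexHull ℝ (p '' B))).Nonempty :=
  interior_eq_empty_of_side (fun e => hij.ne (hp.injective e)) fun _ hx =>
    le_antisymm (hp.side_nonpos hij hA hx.1) (hp.side_nonneg hij hB hx.2)

lemma isExposed_polygon {A F : Set (Fin (n + 3))} (hFA : F ⊆ A) (f : StrongDual ℝ Plane) {c : ℝ}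
    (hF : ∀ k ∈ F, f (p k) = c) (hA : ∀ k ∈ A, k ∉ F → f (p k) < c) :
    IsExposed ℝ (convexHull ℝ (p '' A)) (convexHull ℝ (p '' F)) := by
  intro hne
  have hle : ∀ y ∈ p '' A, f y ≤ c := by
    rintro _ ⟨k, hk, rfl⟩
    by_cases h : k ∈ F
    · exact (hF k h).le
    · exact (hA k hk h).le
  refine ⟨f, Subset.antisymm (fun x hx => ⟨convexHull_mono (image_mono hFA) hx, fun y hy => ?_⟩)
    fun x hx => ?_⟩
  · have h₁ := le_of_mem_convexHull f.toLinearMap hle hy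
    have h₂ := le_of_mem_convexHull (-f).toLinearMap (c := -c) (s := p '' F) (by
      rintro _ ⟨k, hk, rfl⟩
      simp [hF k hk]) hx
    have h₃ : f y ≤ c := h₁
    have h₄ : -f x ≤ -c := h₂
    linarith
  · obtain ⟨k, hk⟩ : F.Nonempty := by
      rw [nonempty_iff_ne_empty]
      rintro rfl
      simp at hne
    have hfx : f x = c := le_antisymm (le_of_mem_convexHull f.toLinearMap hle hx.1)
      ((hF k hk).symm.le.trans (hx.2 _ (subset_convexHull ℝ _ ⟨k, hFA hk, rfl⟩)))
    refine convexHull_mono ?_ (mem_convexHull_face f.toLinearMap hle hx.1 hfx)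
    rintro _ ⟨⟨m, hm, rfl⟩, he⟩
    by_contra hmF
    exact (hA m hm fun h => hmF ⟨m, h, rfl⟩).ne he

lemma IsConvexPolygon.isExposed_of_subset_pair (hp : IsConvexPolygon p) {A F : Set (Fin (n + 3))}
    {i j : Fin (n + 3)} (hij : i < j) (hA : A ⊆ Icc i j ∨ Disjoint A (Ioo i j)) (hFA : F ⊆ A)
    (hF : F ⊆ {i, j}) : IsExposed ℝ (convexHull ℝ (p '' A)) (convexHull ℝ (p '' F)) := by
  by_cases hij' : i ∈ F ∧ j ∈ F
  · have hne : ∀ k ∈ A, k ∉ F → side (p i) (p j) (p k) ≠ 0 := by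
      intro k _ hk h
      rcases (hp.side_eq_zero_iff hij).1 h with rfl | rfl
      · exact hk hij'.1
      · exact hk hij'.2
    have hz : ∀ k ∈ F, crossDual (p i) (p j) (p k) = crossDual (p i) (p j) (p i) := by
      intro k hk
      rcases hF hk with rfl | h
      · rfl
      · rw [mem_singleton_iff.1 h]
        exact crossDual_left_eq_right _ _
    rcases hA with hA | hA
    · refine isExposed_polygon hFA (crossDual (p i) (p j)) hz fun k hk hkF => ?_
      have := ((hp.side_nonpos_iff hij).2 (hA hk)).lt_of_ne (hne k hk hkF)
      simp only [side] at this
      linarith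
    · refine isExposed_polygon hFA (-crossDual (p i) (p j)) (c := -crossDual (p i) (p j) (p i))
        (fun k hk => by simp [hz k hk]) fun k hk hkF => ?_
      have := ((hp.side_nonneg_iff hij).2 (disjoint_left.1 hA hk)).lt_of_ne' (hne k hk hkF)
      simp only [side] at this
      simp only [neg_apply]
      linarith
  · obtain ⟨a, ha⟩ : ∃ a, F ⊆ {a} := by
      by_cases hi : i ∈ F
      · refine ⟨i, fun k hk => (hF hk).resolve_right fun h => hij' ⟨hi, ?_⟩⟩
        rwa [← mem_singleton_iff.1 h]
      · refine ⟨j, fun k hk => (hF hk).resolve_left fun h => hi ?_⟩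
        rwa [← h]
    rcases F.eq_empty_or_nonempty with rfl | ⟨b, hb⟩
    · intro h
      simp at h
    obtain ⟨f, hf⟩ := hp.exists_exposing a
    obtain rfl : b = a := ha hb
    refine isExposed_polygon hFA f (c := f (p b)) (fun k hk => by rw [ha hk]) fun k _ hk => hf k ?_
    rintro rfl
    exact hk hb

/-- The two polygons lie on opposite sides of the line through `p i` and `p j`. Common points are on
this line, hence in the face of the second polygon there, whose vertices can only be `p i` and `p
j`. -/
lemma IsConvexPolygon.inter_eq (hp : IsConvexPolygon p) {A B : Set (Fin (n + 3))}
    {i j : Fin (n + 3)} (hij : i < j) (hi : i ∈ A) (hj : j ∈ A) (hA : A ⊆ Icc i j)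
    (hB : Disjoint B (Ioo i j)) :
    convexHull ℝ (p '' A) ∩ convexHull ℝ (p '' B) = convexHull ℝ (p '' (A ∩ B)) := by
  refine Subset.antisymm (fun x hx => ?_) (subset_inter (convexHull_mono (image_mono
    inter_subset_left)) (convexHull_mono (image_mono inter_subset_right)))
  have h0 : side (p i) (p j) x = 0 :=
    le_antisymm (hp.side_nonpos hij hA hx.1) (hp.side_nonneg hij hB hx.2)
  have := mem_convexHull_face (-crossDual (p i) (p j)).toLinearMap
    (c := -crossDual (p i) (p j) (p i)) (s := p '' B) (by
      rintro _ ⟨k, hk, rfl⟩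
      simpa [side] using (hp.side_nonneg_iff hij).2 (disjoint_left.1 hB hk)) hx.2
    (by simpa [side, sub_eq_zero] using h0)
  refine convexHull_mono ?_ this
  rintro _ ⟨⟨k, hk, rfl⟩, he⟩
  refine ⟨k, ⟨?_, hk⟩, rfl⟩
  have hz : side (p i) (p j) (p k) = 0 := by simpa [side, sub_eq_zero] using he
  rcases (hp.side_eq_zero_iff hij).1 hz with rfl | rfl
  · exact hi
  · exact hj

lemma IsConvexPolygon.isExposed_inter (hp : IsConvexPolygon p) {A B : Set (Fin (n + 3))}
    {i j : Fin (n + 3)} (hij : i < j) (hi : i ∈ A) (hj : j ∈ A) (hA : A ⊆ Icc i j)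
    (hB : Disjoint B (Ioo i j)) :
    IsExposed ℝ (convexHull ℝ (p '' A)) (convexHull ℝ (p '' A) ∩ convexHull ℝ (p '' B)) ∧
      IsExposed ℝ (convexHull ℝ (p '' B)) (convexHull ℝ (p '' A) ∩ convexHull ℝ (p '' B)) := by
  rw [hp.inter_eq hij hi hj hA hB]
  have hF : A ∩ B ⊆ {i, j} := by
    rintro k ⟨hk, hk'⟩
    by_contra h
    simp only [mem_insert_iff, mem_singleton_iff, not_or] at h
    exact disjoint_left.1 hB hk' ⟨(hA hk).1.lt_of_ne' h.1, (hA hk).2.lt_of_ne h.2⟩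
  exact ⟨hp.isExposed_of_subset_pair hij (Or.inl hA) inter_subset_left hF,
    hp.isExposed_of_subset_pair hij (Or.inr hB) inter_subset_right hF⟩

end Interior

/-! ### The subdivision given by the chords of a weight function -/

section ChordSubdivision

open Set

lemma Subdivision.eq_of_cells_eq {m : ℕ} {p : Fin m → Plane} {S T : Subdivision p}
    (h : S.cells = T.cells) : S = T := by
  cases S
  cases T
  congr

lemma Subdivision.eq_of_overlap {m : ℕ} {p : Fin m → Plane} (S : Subdivision p) {C D : Set Plane}
    (hC : C ∈ S.cells) (hD : D ∈ S.cells) (h : (interior (C ∩ D)).Nonempty) : C = D :=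
  ((S.isExposed_inter C hC D hD).1.eq_of_interior_nonempty h).symm.trans
    ((S.isExposed_inter C hC D hD).2.eq_of_interior_nonempty h)

lemma Subdivision.finite_cells {m : ℕ} {p : Fin m → Plane} (S : Subdivision p) :
    S.cells.Finite :=
  (Set.finite_range fun A : Set (Fin m) => convexHull ℝ (p '' A)).subset fun C hC => by
    obtain ⟨A, rfl⟩ := S.exists_vertices C hC
    exact ⟨A, rfl⟩

lemma Subdivision.isClosed_of_mem {m : ℕ} {p : Fin m → Plane} (S : Subdivision p) {C : Set Plane}
    (hC : C ∈ S.cells) : IsClosed C := by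
  obtain ⟨A, rfl⟩ := S.exists_vertices C hC
  exact (Set.Finite.isCompact_convexHull ℝ (Set.toFinite (p '' A))).isClosed

lemma Subdivision.exists_overlap {m : ℕ} {p : Fin m → Plane} (S : Subdivision p) {K : Set Plane}
    (hK : IsClosed K) (hne : (interior K).Nonempty) (hsub : K ⊆ convexHull ℝ (range p)) :
    ∃ C ∈ S.cells, (interior (K ∩ C)).Nonempty :=
  exists_interior_inter_nonempty S.finite_cells (fun _ => S.isClosed_of_mem) hK hne
    (by rwa [S.sUnion_cells])

lemma Subdivision.subset_of_mem {m : ℕ} {p : Fin m → Plane} (S : Subdivision p) {C : Set Plane}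
    (hC : C ∈ S.cells) : C ⊆ convexHull ℝ (range p) := by
  rw [← S.sUnion_cells]
  exact subset_sUnion_of_mem hC

/-- The cells of `S` already cover the polygon, so each cell of `T` overlaps one of them; this one
is also a cell of `T` and therefore the same. -/
lemma Subdivision.eq_of_cells_subset {m : ℕ} {p : Fin m → Plane} {S T : Subdivision p}
    (h : S.cells ⊆ T.cells) : S = T := by
  refine Subdivision.eq_of_cells_eq (Subset.antisymm h fun C hC => ?_)
  obtain ⟨D, hD, hCD⟩ := S.exists_overlap (T.isClosed_of_mem hC) (T.interior_nonempty C hC)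
    (T.subset_of_mem hC)
  rwa [T.eq_of_overlap hC (h hD) hCD]

/-- Refinement is only declared as a preorder. If `C ⊆ D ⊆ C'` with `C` and `C'` in one subdivision,
these overlap and all three agree. -/
lemma Subdivision.le_antisymm {m : ℕ} {p : Fin m → Plane} {S T : Subdivision p} (h : S ≤ T)
    (h' : T ≤ S) : S = T := by
  refine Subdivision.eq_of_cells_subset fun C hC => ?_
  obtain ⟨D, hD, hCD⟩ := h C hC
  obtain ⟨C', hC', hDC⟩ := h' D hD
  have : C = C' := S.eq_of_overlap hC hC' (by
    rw [inter_eq_self_of_subset_left (hCD.trans hDC)]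
    exact S.interior_nonempty C hC)
  subst this
  rwa [hCD.antisymm hDC]

variable {n : ℕ} {p : Fin (n + 3) → Plane} {α : Type*} [LinearOrder α] {v : Fin (n + 3) → α}

/-- The polygons spanned by the cells of the chords of a weight function. -/
def chordPolygons (p : Fin (n + 3) → Plane) (v : Fin (n + 3) → α) : Set (Set Plane) :=
  {C | ∃ l r, IsChord v l r ∧ C = convexHull ℝ (p '' chordCell v l r)}

lemma bot_lt_top_fin : (⊥ : Fin (n + 3)) < ⊤ := bot_lt_top

lemma nonempty_Ioo_bot_top : (Ioo (⊥ : Fin (n + 3)) ⊤).Nonempty :=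
  ⟨1, by simp [bot_eq_zero], by simp [Fin.lt_def, Fin.top_eq_last]⟩

lemma subset_Icc_bot_top (A : Set (Fin (n + 3))) : A ⊆ Icc ⊥ ⊤ := fun _ _ => ⟨bot_le, le_top⟩

lemma IsConvexPolygon.side_bot_top (hp : IsConvexPolygon p) {x : Plane}
    (hx : x ∈ convexHull ℝ (range p)) : side (p ⊥) (p ⊤) x ≤ 0 :=
  hp.side_nonpos bot_lt_top_fin (subset_Icc_bot_top univ) (by rwa [image_univ])

/-- The chords of a weight function subdivide the polygon. -/
def chordSubdivision (hp : IsConvexPolygon p) (hv : Peaked v) : Subdivision p where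
  cells := chordPolygons p v
  exists_vertices := by
    rintro C ⟨l, r, -, rfl⟩
    exact ⟨_, rfl⟩
  interior_nonempty := by
    rintro C ⟨l, r, h, rfl⟩
    obtain ⟨k, hk, hmax⟩ := h.exists_argmax
    exact hp.interior_nonempty (left_mem_chordCell v l r) (Or.inr (Or.inr ⟨hk, hmax⟩))
      (right_mem_chordCell v l r) hk.1 hk.2
  sUnion_cells := by
    refine Subset.antisymm (sUnion_subset ?_) fun x hx => ?_
    · rintro C ⟨l, r, -, rfl⟩
      exact convexHull_image_subset _
    -- The innermost chord with `x` on its outer side. A side of its cell with vertices behind it is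
    -- a smaller chord, so `x` is not beyond it; any other side of the cell is a side of the whole
    -- polygon.
    obtain ⟨g, g', ⟨hg, hgx⟩, hmin⟩ := exists_minimal_pair
      (T := fun l r => IsChord v l r ∧ side (p l) (p r) x ≤ 0)
      ⟨isChord_bot_top hv nonempty_Ioo_bot_top, hp.side_bot_top hx⟩
    refine ⟨_, ⟨g, g', hg, rfl⟩, hp.mem_convexHull_of_side hg.lt (left_mem_chordCell v g g')
      (right_mem_chordCell v g g') hx hgx fun i hi j hj hij hgap => ?_⟩
    by_cases hne : (Ioo i j).Nonempty
    · by_contra! hneg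
      have hi' := chordCell_subset_Icc hg.lt hi
      have hj' := chordCell_subset_Icc hg.lt hj
      obtain ⟨rfl, rfl⟩ := hmin i j ⟨hg.of_adjacent hi hj hne hgap, hneg.le⟩ hi'.1 hj'.2
      obtain ⟨k, hk, hmax⟩ := hg.exists_argmax
      exact hgap k hk (Or.inr (Or.inr ⟨hk, hmax⟩))
    · rw [not_nonempty_iff_eq_empty] at hne
      exact hp.side_nonneg (A := univ) hij (by simp [hne]) (by rwa [image_univ])
  isExposed_inter := by
    rintro _ ⟨l, r, h, rfl⟩ _ ⟨l', r', h', rfl⟩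
    rcases h.not_cut h' with hc | hc
    · rcases h'.not_cut h with hc' | hc'
      · have h₁ := hc (left_mem_chordCell v l' r')
        have h₂ := hc (right_mem_chordCell v l' r')
        have h₃ := hc' (left_mem_chordCell v l r)
        have h₄ := hc' (right_mem_chordCell v l r)
        obtain rfl := _root_.le_antisymm h₁.1 h₃.1
        obtain rfl := _root_.le_antisymm h₂.2 h₄.2
        rw [inter_self]
        exact ⟨IsExposed.refl _, IsExposed.refl _⟩
      · have := hp.isExposed_inter h'.lt (left_mem_chordCell v l' r')
          (right_mem_chordCell v l' r') (chordCell_subset_Icc h'.lt) hc'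
        rw [inter_comm]
        exact this.symm
    · exact hp.isExposed_inter h.lt (left_mem_chordCell v l r) (right_mem_chordCell v l r)
        (chordCell_subset_Icc h.lt) hc

/-- Refinement of subdivisions corresponds to inclusion of the sets of chords. -/
lemma chordSubdivision_le_iff {β : Type*} [LinearOrder β] {v' : Fin (n + 3) → β}
    (hp : IsConvexPolygon p) (hv : Peaked v) (hv' : Peaked v') :
    chordSubdivision hp hv ≤ chordSubdivision hp hv' ↔ ∀ l r, IsChord v' l r → IsChord v l r := by
  constructor
  · intro h l r hlr
    refine hv.isChord_of_not_cut hlr.1 fun g g' hg => ?_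
    obtain ⟨_, ⟨i, j, hij, rfl⟩, hsub⟩ := h _ ⟨g, g', hg, rfl⟩
    rw [hp.convexHull_subset_iff] at hsub
    exact (hlr.not_cut hij).imp (fun h => hsub.trans h) (fun h => h.mono_left hsub)
  · rintro H _ ⟨l, r, h, rfl⟩
    obtain ⟨g, g', hg, hsub⟩ := h.exists_chordCell_subset hv' H
    exact ⟨_, ⟨g, g', hg, rfl⟩, hp.convexHull_subset_iff.2 hsub⟩

end ChordSubdivision

/-! ### The common refinement of the level polygons -/

section LevelPolygons

open Set

variable {n : ℕ} {p : Fin (n + 3) → Plane} {α : Type*} [LinearOrder α] {v : Fin (n + 3) → α}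

/-- The gradient of `l` is orthogonal to `b - a`, so it is a multiple of the normal that defines
`side`. -/
lemma exists_eq_mul_side {a b : Plane} (hab : a ≠ b) (l : StrongDual ℝ Plane) (h : l a = l b) :
    ∃ t : ℝ, ∀ x, l x - l a = t * side a b x := by
  have hl : ∀ x : Plane, l x = x 0 * l (Pi.single 0 1) + x 1 * l (Pi.single 1 1) := by
    intro x
    conv_lhs => rw [show x = x 0 • Pi.single 0 1 + x 1 • Pi.single 1 1 by
      ext k
      fin_cases k <;> simp]
    simp only [map_add, map_smul, smul_eq_mul]
  set α := l (Pi.single 0 1)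
  set β := l (Pi.single 1 1)
  have hd : 0 < (b 0 - a 0) ^ 2 + (b 1 - a 1) ^ 2 := by
    by_contra! hle
    apply hab
    have h₀ : (b 0 - a 0) ^ 2 = 0 := by nlinarith [sq_nonneg (b 0 - a 0), sq_nonneg (b 1 - a 1)]
    have h₁ : (b 1 - a 1) ^ 2 = 0 := by nlinarith [sq_nonneg (b 0 - a 0), sq_nonneg (b 1 - a 1)]
    ext k
    fin_cases k
    · simpa using (sub_eq_zero.1 (pow_eq_zero_iff two_ne_zero |>.1 h₀)).symm
    · simpa using (sub_eq_zero.1 (pow_eq_zero_iff two_ne_zero |>.1 h₁)).symm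
  have h0 : α * (b 0 - a 0) + β * (b 1 - a 1) = 0 := by
    rw [hl a, hl b] at h
    linarith
  refine ⟨(β * (b 0 - a 0) - α * (b 1 - a 1)) / ((b 0 - a 0) ^ 2 + (b 1 - a 1) ^ 2),
    fun x => ?_⟩
  rw [hl x, hl a, side_eq, div_mul_eq_mul_div, eq_div_iff hd.ne']
  linear_combination ((x 0 - a 0) * (b 0 - a 0) + (x 1 - a 1) * (b 1 - a 1)) * h0

lemma IsConvexPolygon.setOf_side_nonpos (hp : IsConvexPolygon p) {i j : Fin (n + 3)}
    (hij : i < j) : {x ∈ convexHull ℝ (range p) | side (p i) (p j) x ≤ 0} =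
      convexHull ℝ (p '' Icc i j) := by
  ext x
  constructor
  · rintro ⟨hx, hx'⟩
    have := hp.mem_convexHull_inter_Icc hij (mem_univ i) (mem_univ j) (by rwa [image_univ]) hx'
    rwa [univ_inter] at this
  · exact fun hx => ⟨convexHull_image_subset _ hx, hp.side_nonpos hij Subset.rfl hx⟩

/-- The cells of the subdivision induced by a polygon: the polygon itself and the polygons spanned
by the gaps between consecutive vertices. -/
lemma IsConvexPolygon.mem_inducedCells (hp : IsConvexPolygon p) {A : Set (Fin (n + 3))}
    (hbot : ⊥ ∈ A) (htop : ⊤ ∈ A) {C : Set Plane} :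
    C ∈ inducedCells (convexHull ℝ (range p)) (convexHull ℝ (p '' A)) ↔
      (interior C).Nonempty ∧ (C = convexHull ℝ (p '' A) ∨ ∃ i ∈ A, ∃ j ∈ A, i < j ∧
        Disjoint A (Ioo i j) ∧ C = convexHull ℝ (p '' Icc i j)) := by
  refine and_congr_right fun hC => or_congr_right ⟨?_, ?_⟩
  · rintro ⟨l, hl0, hlne, rfl⟩
    obtain ⟨x₀, hx₀, y₀, hy₀, hxy⟩ := hlne
    set c := l x₀ with hc
    have hA : ∀ k ∈ A, l (p k) ≤ c := fun k hk =>
      hx₀.2 _ (subset_convexHull ℝ _ ⟨k, hk, rfl⟩)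
    have hface : ∀ z ∈ l.toExposed (convexHull ℝ (p '' A)),
        z ∈ convexHull ℝ (p '' {k ∈ A | l (p k) = c}) := by
      intro z hz
      have := mem_convexHull_face l.toLinearMap (c := c) (s := p '' A)
        (by rintro _ ⟨k, hk, rfl⟩; exact hA k hk) hz.1
        (le_antisymm (hx₀.2 z hz.1) (hz.2 x₀ hx₀.1))
      refine convexHull_mono ?_ this
      rintro _ ⟨⟨k, hk, rfl⟩, he⟩
      exact ⟨k, ⟨hk, he⟩, rfl⟩
    obtain ⟨i, ⟨hi, hil⟩, j, ⟨hj, hjl⟩, hij⟩ : ∃ i ∈ {k ∈ A | l (p k) = c},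
        ∃ j ∈ {k ∈ A | l (p k) = c}, i < j := by
      by_contra! hno
      have hsub : {k ∈ A | l (p k) = c}.Subsingleton := fun i hi j hj =>
        le_antisymm (hno j hj i hi) (hno i hi j hj)
      have h₁ := hface x₀ hx₀
      have h₂ := hface y₀ hy₀
      rw [(hsub.image p).convex.convexHull_eq] at h₁ h₂
      exact hxy (hsub.image p h₁ h₂)
    obtain ⟨t, ht⟩ := exists_eq_mul_side (fun e => hij.ne (hp.injective e)) l (hil.trans hjl.symm)
    rw [hil] at ht
    have hCmem : ∀ x, (∀ y ∈ convexHull ℝ (p '' A), l y ≤ l x) ↔ c ≤ l x := fun x =>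
      ⟨fun h => h x₀ hx₀.1, fun h y hy => (hx₀.2 y hy).trans h⟩
    have ht0 : t ≠ 0 := by
      rintro rfl
      refine hl0 (StrongDual.eq_zero_of_isMax_interior (C := univ) (by simp) fun x _ y _ => ?_)
      have h₁ := ht x
      have h₂ := ht y
      linarith
    rcases ht0.lt_or_gt with ht0 | ht0
    · refine ⟨i, hi, j, hj, hij, ?_, ?_⟩
      · refine disjoint_left.2 fun k hk => (hp.side_nonneg_iff hij).1 ?_
        have h₁ := hA k hk
        have h₂ := ht (p k)
        nlinarith
      · rw [← hp.setOf_side_nonpos hij]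
        ext x
        refine and_congr_right fun _ => (hCmem x).trans ?_
        have := ht x
        constructor <;> intro <;> nlinarith
    -- Here the polygon lies to the right of the edge. Since it contains the first and the last
    -- vertex, the edge is the base side, and nothing two-dimensional lies beyond it.
    · exfalso
      have hA' : A ⊆ Icc i j := fun k hk => (hp.side_nonpos_iff hij).1 (by
        have h₁ := hA k hk
        have h₂ := ht (p k)
        nlinarith)
      obtain rfl : ⊥ = i := le_antisymm bot_le (hA' hbot).1
      obtain rfl : j = ⊤ := le_antisymm le_top (hA' htop).2
      refine interior_eq_empty_of_side (fun e => hij.ne (hp.injective e)) (fun x hx => ?_) hC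
      refine le_antisymm (hp.side_bot_top hx.1) ?_
      have h₁ := (hCmem x).1 hx.2
      have h₂ := ht x
      nlinarith
  · rintro ⟨i, hi, j, hj, hij, hdisj, rfl⟩
    have hne : p i ≠ p j := fun e => hij.ne (hp.injective e)
    have hmem : ∀ x, (∀ y ∈ convexHull ℝ (p '' A), (-crossDual (p i) (p j)) y ≤
        (-crossDual (p i) (p j)) x) ↔ side (p i) (p j) x ≤ 0 := by
      intro x
      constructor
      · intro h
        have := h (p i) (subset_convexHull ℝ _ ⟨i, hi, rfl⟩)
        simp only [side, neg_apply] at this ⊢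
        linarith
      · intro h y hy
        have := hp.side_nonneg hij hdisj hy
        simp only [side, neg_apply] at this h ⊢
        linarith
    refine ⟨-crossDual (p i) (p j), neg_ne_zero.2 (crossDual_ne_zero hne), ?_, ?_⟩
    · exact ⟨p i, ⟨subset_convexHull ℝ _ ⟨i, hi, rfl⟩, (hmem _).2 (side_left _ _).le⟩,
        p j, ⟨subset_convexHull ℝ _ ⟨j, hj, rfl⟩, (hmem _).2 (side_right _ _).le⟩, hne⟩
    · rw [← hp.setOf_side_nonpos hij]
      ext x
      exact and_congr_right fun _ => (hmem x).symm

lemma IsConvexPolygon.eq_of_inducedCells_overlap (hp : IsConvexPolygon p) {A : Set (Fin (n + 3))}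
    (hbot : ⊥ ∈ A) (htop : ⊤ ∈ A) {C D : Set Plane}
    (hC : C ∈ inducedCells (convexHull ℝ (range p)) (convexHull ℝ (p '' A)))
    (hD : D ∈ inducedCells (convexHull ℝ (range p)) (convexHull ℝ (p '' A)))
    (h : (interior (C ∩ D)).Nonempty) : C = D := by
  rcases ((hp.mem_inducedCells hbot htop).1 hC).2 with rfl | ⟨i, hi, j, hj, hij, hA, rfl⟩ <;>
  rcases ((hp.mem_inducedCells hbot htop).1 hD).2 with rfl | ⟨i', hi', j', hj', hij', hA', rfl⟩
  · rfl
  · rw [inter_comm] at h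
    exact absurd h (hp.inter_not_overlap hij' Subset.rfl hA')
  · exact absurd h (hp.inter_not_overlap hij Subset.rfl hA)
  · by_cases hdisj : Disjoint (Icc i' j') (Ioo i j)
    · exact absurd h (hp.inter_not_overlap hij Subset.rfl hdisj)
    · obtain ⟨k, hk', hk⟩ := not_disjoint_iff.1 hdisj
      have h₁ : i ≤ i' := not_lt.1 fun hlt =>
        disjoint_left.1 hA' hi ⟨hlt, hk.1.trans_le hk'.2⟩
      have h₂ : i' ≤ i := not_lt.1 fun hlt =>
        disjoint_left.1 hA hi' ⟨hlt, hk'.1.trans_lt hk.2⟩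
      have h₃ : j' ≤ j := not_lt.1 fun hlt =>
        disjoint_left.1 hA' hj ⟨hk'.1.trans_lt hk.2, hlt⟩
      have h₄ : j ≤ j' := not_lt.1 fun hlt =>
        disjoint_left.1 hA hj' ⟨hk.1.trans_le hk'.2, hlt⟩
      rw [le_antisymm h₁ h₂, le_antisymm h₃ h₄]

lemma Peaked.le_bot (hv : Peaked v) (h : v ⊥ = v ⊤) (k : Fin (n + 3)) : v k ≤ v ⊥ := by
  by_cases h₁ : k = ⊥
  · rw [h₁]
  by_cases h₂ : k = ⊤
  · rw [h₂, h]
  exact (hv k h₁ h₂).1.le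

/-- The common refinement of the subdivisions induced by the level polygons of a weight function
consists of the cells of its chords. -/
lemma commonRefinement_inducedCells (hp : IsConvexPolygon p) (hv : Peaked v) (hbt : v ⊥ = v ⊤) :
    (commonRefinement fun k => inducedCells (convexHull ℝ (range p))
      (convexHull ℝ (p '' {i | v k ≤ v i}))) = chordPolygons p v := by
  have hbot : ∀ k, ⊥ ∈ {i | v k ≤ v i} := fun k => hv.le_bot hbt k
  have htop : ∀ k, ⊤ ∈ {i | v k ≤ v i} := fun k => (hv.le_bot hbt k).trans hbt.le
  have key : chordPolygons p v ⊆ commonRefinement fun k => inducedCells (convexHull ℝ (range p))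
      (convexHull ℝ (p '' {i | v k ≤ v i})) := by
    rintro C ⟨l, r, h, rfl⟩
    have hint : (interior (convexHull ℝ (p '' chordCell v l r))).Nonempty :=
      (chordSubdivision hp hv).interior_nonempty _ ⟨l, r, h, rfl⟩
    obtain ⟨m, hm, hmax⟩ := h.exists_argmax
    have hmle : ∀ i ∈ chordCell v l r, v m ≤ v i := by
      rintro i (rfl | rfl | hi)
      · exact (h.2 m hm).1.le
      · exact (h.2 m hm).2.le
      · exact hi.2 m hm
    -- The cell of level `k` around the chord cell is `H_k` if `v k ≤ v m`, and otherwise the part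
    -- beyond the edge of `H_k` that passes over `m`. If `l` and `r` also reach level `k`, that edge
    -- joins `l` and `r`.
    have hex : ∀ k, ∃ D ∈ inducedCells (convexHull ℝ (range p))
        (convexHull ℝ (p '' {i | v k ≤ v i})), convexHull ℝ (p '' chordCell v l r) ⊆ D ∧
          (v k ≤ v m → D = convexHull ℝ (p '' {i | v k ≤ v i})) ∧
          (v m < v k → v k ≤ v l → v k ≤ v r → D = convexHull ℝ (p '' Icc l r)) := by
      intro k
      by_cases hk : v k ≤ v m
      · have hsub : convexHull ℝ (p '' chordCell v l r) ⊆ convexHull ℝ (p '' {i | v k ≤ v i}) :=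
          convexHull_mono (image_mono fun i hi => hk.trans (hmle i hi))
        exact ⟨_, (hp.mem_inducedCells (hbot k) (htop k)).2
          ⟨hint.mono (interior_mono hsub), Or.inl rfl⟩, hsub, fun _ => rfl,
          fun hk' => absurd hk hk'.not_ge⟩
      · have hdisj : ∀ x ∈ Ioo l r, ¬ v k ≤ v x := fun x hx hle => hk (hle.trans (hmax x hx))
        obtain ⟨i, hi, j, hj, -, him, hmj, -, hgap⟩ := exists_adjacent (A := {i | v k ≤ v i})
          (hdisj m hm) (hbot k) (bot_le.trans_lt hm.1) (htop k) (hm.2.trans_le le_top)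
        have hil : i ≤ l := not_lt.1 fun hlt => hdisj i ⟨hlt, him.trans hm.2⟩ hi
        have hjr : r ≤ j := not_lt.1 fun hlt => hdisj j ⟨hm.1.trans hmj, hlt⟩ hj
        have hsub : convexHull ℝ (p '' chordCell v l r) ⊆ convexHull ℝ (p '' Icc i j) :=
          convexHull_mono (image_mono ((chordCell_subset_Icc h.lt).trans
            (Icc_subset_Icc hil hjr)))
        refine ⟨_, (hp.mem_inducedCells (hbot k) (htop k)).2 ⟨hint.mono (interior_mono hsub),
          Or.inr ⟨i, hi, j, hj, him.trans hmj, disjoint_right.2 hgap, rfl⟩⟩, hsub,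
          fun hk' => absurd hk' hk, fun _ h₁ h₂ => ?_⟩
        have hli : l ≤ i := not_lt.1 fun hlt => hgap l ⟨hlt, hm.1.trans hmj⟩ h₁
        have hrj : j ≤ r := not_lt.1 fun hlt => hgap r ⟨him.trans hm.2, hlt⟩ h₂
        rw [le_antisymm hil hli, le_antisymm hrj hjr]
    choose D hD hsub hDm hDlr using hex
    refine ⟨hint, D, hD, Subset.antisymm (subset_iInter hsub) fun x hx => ?_⟩
    rw [mem_iInter] at hx
    have h₁ := hx m
    rw [hDm m le_rfl] at h₁
    -- Two levels suffice: that of `m`, and that of the lighter end of the chord, which cuts out the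
    -- vertices from `l` to `r`.
    have h₂ : x ∈ convexHull ℝ (p '' Icc l r) := by
      rcases le_total (v l) (v r) with hle | hle
      · have := hx l
        rwa [hDlr l (h.2 m hm).1 le_rfl hle] at this
      · have := hx r
        rwa [hDlr r (h.2 m hm).2 hle le_rfl] at this
    refine convexHull_mono (image_mono ?_) (hp.mem_convexHull_inter_Icc h.lt (h.2 m hm).1.le
      (h.2 m hm).2.le h₁ (hp.side_nonpos h.lt Subset.rfl h₂))
    rintro i ⟨hi, hi'⟩
    rcases hi'.1.eq_or_lt with rfl | hli
    · exact left_mem_chordCell _ _ _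
    rcases hi'.2.eq_or_lt with rfl | hir
    · exact right_mem_chordCell _ _ _
    exact Or.inr (Or.inr ⟨⟨hli, hir⟩, fun j hj => (hmax j hj).trans hi⟩)
  refine Subset.antisymm ?_ key
  rintro C ⟨hC, c, hc, rfl⟩
  have hcell : ∀ k, ∃ A : Set (Fin (n + 3)), c k = convexHull ℝ (p '' A) := by
    intro k
    rcases ((hp.mem_inducedCells (hbot k) (htop k)).1 (hc k)).2 with h | ⟨i, -, j, -, -, -, h⟩
    · exact ⟨_, h⟩
    · exact ⟨_, h⟩
  have hclosed : IsClosed (⋂ k, c k) := isClosed_iInter fun k => by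
    obtain ⟨A, hA⟩ := hcell k
    rw [hA]
    exact isClosed_polygon A
  -- The chord cells cover the polygon, so one of them overlaps the given intersection. At each
  -- level the two chosen cells then overlap, hence agree.
  obtain ⟨R, hR, hRC⟩ := (chordSubdivision hp hv).exists_overlap hclosed hC (by
    obtain ⟨A, hA⟩ := hcell ⊥
    refine (iInter_subset _ ⊥).trans ?_
    rw [hA]
    exact convexHull_image_subset A)
  obtain ⟨-, d, hd, rfl⟩ := key hR
  have : c = d := funext fun k => hp.eq_of_inducedCells_overlap (hbot k) (htop k) (hc k) (hd k)
    (hRC.mono (interior_mono (inter_subset_inter (iInter_subset _ k) (iInter_subset _ k))))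
  subst this
  exact hR

end LevelPolygons

/-! ### Every subdivision is given by its diagonals -/

section Diagonals

open Set

variable {n : ℕ} {p : Fin (n + 3) → Plane}

/-- The pairs of vertices whose connecting line does not cut any cell of a subdivision. -/
def Subdivision.diagonals (S : Subdivision p) : Set (Fin (n + 3) × Fin (n + 3)) :=
  {d | (Ioo d.1 d.2).Nonempty ∧ ∀ A : Set (Fin (n + 3)), convexHull ℝ (p '' A) ∈ S.cells →
    A ⊆ Icc d.1 d.2 ∨ Disjoint A (Ioo d.1 d.2)}

lemma exists_openSegment_side_eq_zero {a b x y : Plane} (hx : side a b x < 0)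
    (hy : 0 < side a b y) : ∃ u ∈ openSegment ℝ x y, side a b u = 0 := by
  have hpos : 0 < side a b y - side a b x := by linarith
  refine ⟨(side a b y / (side a b y - side a b x)) • x +
    (-side a b x / (side a b y - side a b x)) • y,
    ⟨_, _, div_pos hy hpos, div_pos (by linarith) hpos, ?_, rfl⟩, ?_⟩
  · rw [← add_div, ← sub_eq_add_neg, div_self hpos.ne']
  · have h : side a b y / (side a b y - side a b x) +
        -side a b x / (side a b y - side a b x) = 1 := by
      rw [← add_div, ← sub_eq_add_neg, div_self hpos.ne']
    have h₂ : side a b y / (side a b y - side a b x) * side a b x +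
        -side a b x / (side a b y - side a b x) * side a b y = 0 := by ring
    set s := side a b y / (side a b y - side a b x)
    set t := -side a b x / (side a b y - side a b x)
    simp only [side, map_add, map_smul, smul_eq_mul] at h₂ ⊢
    linear_combination h₂ + crossDual a b a * h

lemma openSegment_subset_hull (i j : Fin (n + 3)) {A : Set (Fin (n + 3))} (hi : i ∈ A)
    (hj : j ∈ A) : openSegment ℝ (p i) (p j) ⊆ convexHull ℝ (p '' A) :=
  (openSegment_subset_segment ℝ _ _).trans ((convex_convexHull ℝ _).segment_subset
    (subset_convexHull ℝ _ ⟨i, hi, rfl⟩) (subset_convexHull ℝ _ ⟨j, hj, rfl⟩))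

lemma side_eq_zero_of_mem_segment {a b u : Plane} (hu : u ∈ segment ℝ a b) : side a b u = 0 := by
  obtain ⟨s, t, -, -, hst, rfl⟩ := hu
  have := crossDual_left_eq_right a b
  simp only [side, map_add, map_smul, smul_eq_mul, this]
  linear_combination crossDual a b a * hst

/-- A point `u` where the diagonals cross lies in some cell. This cell is on one side of the first
diagonal, so `u` is in its face on that line; being neither end, `u` forces both ends to be vertices
of the cell. The second diagonal then cuts it. -/
lemma Subdivision.not_crossing (hp : IsConvexPolygon p) (S : Subdivision p) :
    ∀ d ∈ S.diagonals, ∀ e ∈ S.diagonals, d.1 < e.1 → e.1 < d.2 → d.2 < e.2 → False := by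
  rintro ⟨i, j⟩ hd ⟨i', j'⟩ he (h₁ : i < i') (h₂ : i' < j) (h₃ : j < j')
  have hij : i < j := h₁.trans h₂
  have hij' : i' < j' := h₂.trans h₃
  obtain ⟨u, hu, hu0⟩ := exists_openSegment_side_eq_zero (hp.side_neg ⟨h₁, h₂⟩)
    (hp.side_pos_of_gt hij h₃)
  have hu' : side (p i') (p j') u = 0 :=
    side_eq_zero_of_mem_segment (openSegment_subset_segment ℝ _ _ hu)
  have huQ : u ∈ ⋃₀ S.cells := by
    rw [S.sUnion_cells, ← image_univ]
    exact openSegment_subset_hull i' j' (mem_univ _) (mem_univ _) hu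
  obtain ⟨C, hC, huC⟩ := huQ
  obtain ⟨A, rfl⟩ := S.exists_vertices C hC
  have hface : u ∈ convexHull ℝ (p '' (A ∩ {i, j})) := by
    rcases hd.2 A hC with hA | hA
    · have := mem_convexHull_face (crossDual (p i) (p j)).toLinearMap
        (c := crossDual (p i) (p j) (p i)) (s := p '' A) (by
          rintro _ ⟨k, hk, rfl⟩
          simpa [side] using (hp.side_nonpos_iff hij).2 (hA hk)) huC
        (by simpa [side, sub_eq_zero] using hu0)
      refine convexHull_mono ?_ this
      rintro _ ⟨⟨k, hk, rfl⟩, hk'⟩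
      exact ⟨k, ⟨hk, (hp.side_eq_zero_iff hij).1 (by simpa [side, sub_eq_zero] using hk')⟩, rfl⟩
    · have := mem_convexHull_face (-crossDual (p i) (p j)).toLinearMap
        (c := -crossDual (p i) (p j) (p i)) (s := p '' A) (by
          rintro _ ⟨k, hk, rfl⟩
          simpa [side] using (hp.side_nonneg_iff hij).2 (disjoint_left.1 hA hk)) huC
        (by simpa [side, sub_eq_zero] using hu0)
      refine convexHull_mono ?_ this
      rintro _ ⟨⟨k, hk, rfl⟩, hk'⟩
      exact ⟨k, ⟨hk, (hp.side_eq_zero_iff hij).1 (by simpa [side, sub_eq_zero] using hk')⟩, rfl⟩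
  have hiside : 0 < side (p i') (p j') (p i) := hp.side_pos_of_lt hij' h₁
  have hjside : side (p i') (p j') (p j) < 0 := hp.side_neg ⟨h₂, h₃⟩
  have hiA : i ∈ A := by
    by_contra hi
    have hsub : A ∩ {i, j} ⊆ {j} := fun k hk =>
      hk.2.resolve_left fun e => hi (e ▸ hk.1)
    have := convexHull_mono (𝕜 := ℝ) (image_mono (f := p) hsub) hface
    rw [image_singleton, convexHull_singleton, mem_singleton_iff] at this
    rw [this] at hu'
    exact hjside.ne hu'
  have hjA : j ∈ A := by
    by_contra hj
    have hsub : A ∩ {i, j} ⊆ {i} := fun k hk =>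
      hk.2.resolve_right fun e => hj (mem_singleton_iff.1 e ▸ hk.1)
    have := convexHull_mono (𝕜 := ℝ) (image_mono (f := p) hsub) hface
    rw [image_singleton, convexHull_singleton, mem_singleton_iff] at this
    rw [this] at hu'
    exact hiside.ne' hu'
  rcases he.2 A hC with h | h
  · exact absurd (h hiA).1 h₁.not_ge
  · exact disjoint_left.1 h hjA ⟨h₂, h₃⟩

/-- No cell of a subdivision is cut by the edges of another one. -/
lemma Subdivision.mem_diagonals_of_edge (hp : IsConvexPolygon p) (S : Subdivision p)
    {A : Set (Fin (n + 3))} (hA : convexHull ℝ (p '' A) ∈ S.cells) {i j : Fin (n + 3)}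
    (hi : i ∈ A) (hj : j ∈ A) (hne : (Ioo i j).Nonempty)
    (hside : A ⊆ Icc i j ∨ Disjoint A (Ioo i j)) : (i, j) ∈ S.diagonals := by
  refine ⟨hne, fun B hB => ?_⟩
  have hij : i < j := hne.elim fun k hk => hk.1.trans hk.2
  by_contra! hcut
  obtain ⟨hy, hx⟩ := hcut
  obtain ⟨y, hyB, hy⟩ := not_subset.1 hy
  obtain ⟨x, hxB, hx⟩ := not_disjoint_iff.1 hx
  have hy' : 0 < side (p i) (p j) (p y) := not_le.1 fun h => hy ((hp.side_nonpos_iff hij).1 h)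
  obtain ⟨u, hu, hu0⟩ := exists_openSegment_side_eq_zero (hp.side_neg hx) hy'
  have huB := openSegment_subset_hull x y hxB hyB hu
  have huA := hp.mem_pair_of_side_eq_zero hij.ne (convexHull_image_subset B huB) hu0 hi hj
  -- The point `u` lies in the common face of both cells and strictly between `p x` and `p y`. Faces
  -- are extreme, so `x` and `y` are vertices of `A`, on both sides of its own edge.
  have hext := (S.isExposed_inter _ hA _ hB).2.isExtreme
  have hpx : p x ∈ convexHull ℝ (p '' B) := subset_convexHull ℝ _ ⟨x, hxB, rfl⟩
  have hpy : p y ∈ convexHull ℝ (p '' B) := subset_convexHull ℝ _ ⟨y, hyB, rfl⟩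
  have h₁ := hext.left_mem_of_mem_openSegment hpx hpy ⟨huA, huB⟩ hu
  rw [openSegment_symm] at hu
  have h₂ := hext.left_mem_of_mem_openSegment hpy hpx ⟨huA, huB⟩ hu
  rcases hside with h | h
  · exact hy (h (hp.mem_convexHull_iff.1 h₂.1))
  · exact disjoint_left.1 h (hp.mem_convexHull_iff.1 h₁.1) hx

/-- A subdivision is determined by its diagonals. -/
lemma Subdivision.eq_chordSubdivision {α : Type*} [LinearOrder α] {v : Fin (n + 3) → α}
    (hp : IsConvexPolygon p) (S : Subdivision p) (hv : Peaked v)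
    (h : ∀ l r, IsChord v l r ↔ (l, r) ∈ S.diagonals) : S = chordSubdivision hp hv := by
  refine Subdivision.eq_of_cells_subset fun C hC => ?_
  obtain ⟨A, rfl⟩ := S.exists_vertices C hC
  obtain ⟨l, hl, r, hr, hA, t, ht, htl⟩ := hp.exists_mem_Ioo (S.interior_nonempty _ hC)
  refine ⟨l, r, (h l r).2 (S.mem_diagonals_of_edge hp hC hl hr ⟨t, htl⟩ (Or.inl hA)), ?_⟩
  rw [← hv.eq_chordCell hl hr hA ht htl
    (fun i hi j hj hne hgap => (h i j).2 (S.mem_diagonals_of_edge hp hC hi hj hne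
      (Or.inr (disjoint_right.2 hgap))))
    fun i j hij => ((h i j).1 hij).2 A hC]

end Diagonals

/-! ### Faces of Minkowski sums -/

section Minkowski

open Set

/-- Any one summand can be replaced independently of the others, so a maximal sum has maximal
summands. -/
lemma mem_toExposed_sum {E κ : Type*} [AddCommGroup E] [Module ℝ E] [TopologicalSpace E]
    (l : StrongDual ℝ E) {t : Finset κ} {K : κ → Set E} {y : κ → E} (hy : ∀ k ∈ t, y k ∈ K k) :
    ∑ k ∈ t, y k ∈ l.toExposed (∑ k ∈ t, K k) ↔ ∀ k ∈ t, y k ∈ l.toExposed (K k) := by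
  classical
  constructor
  · intro h k hk
    refine ⟨hy k hk, fun z hz => ?_⟩
    have := h.2 (∑ m ∈ t, Function.update y k z m) (Set.mem_finsetSum _ _ _ |>.2
      ⟨Function.update y k z, fun {m} hm => by
        rcases eq_or_ne m k with rfl | hmk
        · simpa using hz
        · simpa [hmk] using hy m hm, rfl⟩)
    rw [Finset.sum_update_of_mem hk, ← Finset.add_sum_erase _ _ hk, Finset.sdiff_singleton_eq_erase,
      map_add, map_add] at this
    linarith
  · intro h
    refine ⟨Set.mem_finsetSum _ _ _ |>.2 ⟨y, fun {m} hm => hy m hm, rfl⟩, fun z hz => ?_⟩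
    obtain ⟨g, hg, rfl⟩ := (Set.mem_finsetSum _ _ _).1 hz
    rw [map_sum, map_sum]
    exact Finset.sum_le_sum fun k hk => (h k hk).2 _ (hg hk)

lemma finite_finsetSum {E κ : Type*} [AddCommMonoid E] (t : Finset κ) {K : κ → Set E}
    (hK : ∀ k ∈ t, (K k).Finite) : (∑ k ∈ t, K k).Finite := by
  classical
  induction t using Finset.induction_on with
  | empty => simp
  | insert k t hk ih =>
    rw [Finset.sum_insert hk]
    exact (hK k (Finset.mem_insert_self _ _)).add
      (ih fun m hm => hK m (Finset.mem_insert_of_mem hm))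

/-- An extreme point of a polytope is the unique maximum of a linear functional. -/
lemma IsPolytope.exists_toExposed_eq_singleton {E : Type*} [NormedAddCommGroup E] [NormedSpace ℝ E]
    {P : Set E} (hP : IsPolytope P) {x : E} (hx : x ∈ P.extremePoints ℝ) :
    ∃ w : StrongDual ℝ E, w.toExposed P = {x} := by
  obtain ⟨s, hs, rfl⟩ := hP
  have hxs : x ∈ s := extremePoints_convexHull_subset hx
  have hx' : x ∉ convexHull ℝ (s \ {x}) := fun h =>
    ((convex_convexHull ℝ s).mem_extremePoints_iff_mem_sdiff_convexHull_sdiff.1 hx).2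
      (convexHull_mono (sdiff_subset_sdiff_left (subset_convexHull ℝ s)) h)
  obtain ⟨f, u, hfx, hu⟩ := geometric_hahn_banach_point_closed (convex_convexHull ℝ (s \ {x}))
    (hs.sdiff.isCompact_convexHull ℝ).isClosed hx'
  have hlt : ∀ y ∈ s, y ≠ x → (-f) y < (-f) x := by
    intro y hy hne
    have := hu y (subset_convexHull ℝ _ ⟨hy, hne⟩)
    simp only [neg_apply]
    linarith
  have hle : ∀ y ∈ s, (-f).toLinearMap y ≤ (-f) x := by
    intro y hy
    rcases eq_or_ne y x with rfl | hne
    · exact le_rfl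
    · exact (hlt y hy hne).le
  refine ⟨-f, Subset.antisymm (fun y hy => ?_) ?_⟩
  · have := mem_convexHull_face (-f).toLinearMap hle hy.1
      (le_antisymm (le_of_mem_convexHull _ hle hy.1) (hy.2 x (subset_convexHull ℝ s hxs)))
    have hsub : {z ∈ s | (-f).toLinearMap z = (-f) x} ⊆ {x} := by
      rintro z ⟨hz, hz'⟩
      by_contra hne
      exact (hlt z hz hne).ne hz'
    simpa using convexHull_mono (𝕜 := ℝ) hsub this
  · rintro _ rfl
    exact ⟨subset_convexHull ℝ s hxs, fun z hz => le_of_mem_convexHull _ hle hz⟩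

variable {n : ℕ} {a : Fin (n + 1) → Fin (n + 1) → ℝ}

/-- The pairs `i ≤ j`. -/
def intervals (n : ℕ) : Finset (Σ _ : Fin (n + 1), Fin (n + 1)) :=
  Finset.univ.sigma fun i => Finset.Ici i

lemma mem_intervals {x : Σ _ : Fin (n + 1), Fin (n + 1)} : x ∈ intervals n ↔ x.1 ≤ x.2 := by
  simp [intervals]

lemma minkowskiAss_eq (a : Fin (n + 1) → Fin (n + 1) → ℝ) :
    minkowskiAss a = ∑ x ∈ intervals n, a x.1 x.2 • intervalSimplex x.1 x.2 := by
  rw [minkowskiAss, intervals, Finset.sum_sigma]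

lemma single_mem_intervalSimplex {i j k : Fin (n + 1)} (hk : k ∈ Icc i j) :
    Pi.single k (1 : ℝ) ∈ intervalSimplex i j :=
  subset_convexHull ℝ _ ⟨k, hk, rfl⟩

lemma smul_single_mem_toExposed_iff (w : StrongDual ℝ (Fin (n + 1) → ℝ)) {s : ℝ} (hs : 0 < s)
    {i j k : Fin (n + 1)} (hk : k ∈ Icc i j) :
    s • Pi.single k (1 : ℝ) ∈ w.toExposed (s • intervalSimplex i j) ↔
      ∀ m ∈ Icc i j, w (Pi.single m 1) ≤ w (Pi.single k 1) := by
  constructor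
  · intro h m hm
    have := h.2 _ (smul_mem_smul_set (a := s) (single_mem_intervalSimplex hm))
    rw [map_smul, map_smul, smul_eq_mul, smul_eq_mul] at this
    exact le_of_mul_le_mul_left this hs
  · intro h
    refine ⟨smul_mem_smul_set (single_mem_intervalSimplex hk), ?_⟩
    rintro _ ⟨z, hz, rfl⟩
    simp only [map_smul, smul_eq_mul]
    refine mul_le_mul_of_nonneg_left (le_of_mem_convexHull w.toLinearMap ?_ hz) hs.le
    rintro _ ⟨m, hm, rfl⟩
    exact h m hm

/-- The face of a simplex is the hull of its maximal vertices, and by assumption those for `w` are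
maximal for `w'`. -/
lemma toExposed_smul_intervalSimplex_subset {w w' : StrongDual ℝ (Fin (n + 1) → ℝ)} {s : ℝ}
    (hs : 0 < s) {i j : Fin (n + 1)} (hij : i ≤ j)
    (h : ∀ k ∈ Icc i j, (∀ m ∈ Icc i j, w (Pi.single m 1) ≤ w (Pi.single k 1)) →
      ∀ m ∈ Icc i j, w' (Pi.single m 1) ≤ w' (Pi.single k 1)) :
    w.toExposed (s • intervalSimplex i j) ⊆ w'.toExposed (s • intervalSimplex i j) := by
  obtain ⟨k, hk, hmax⟩ := Set.exists_max_image (Icc i j) (fun m => w (Pi.single m 1))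
    (Set.toFinite _) ⟨i, le_rfl, hij⟩
  rintro _ ⟨⟨y, hy, rfl⟩, hmaxy⟩
  have hmem := (smul_single_mem_toExposed_iff w' hs hk).2 (h k hk hmax)
  refine ⟨smul_mem_smul_set hy, fun z hz => (hmem.2 z hz).trans ?_⟩
  have hwy : w (Pi.single k 1) ≤ w y := by
    have := hmaxy _ (smul_mem_smul_set (a := s) (single_mem_intervalSimplex hk))
    simp only [map_smul, smul_eq_mul] at this
    exact le_of_mul_le_mul_left this hs
  have hle : ∀ e ∈ (fun k : Fin (n + 1) => Pi.single k (1 : ℝ)) '' Icc i j,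
      w.toLinearMap e ≤ w (Pi.single k 1) := by
    rintro _ ⟨m, hm, rfl⟩
    exact hmax m hm
  have := mem_convexHull_face w.toLinearMap hle hy
    (le_antisymm (le_of_mem_convexHull _ hle hy) hwy)
  have hw' := le_of_mem_convexHull (-w').toLinearMap (c := -w' (Pi.single k 1)) (by
    rintro _ ⟨⟨m, hm, rfl⟩, he⟩
    have h₁ := h m hm (fun m' hm' => (hmax m' hm').trans (le_of_eq he.symm)) k hk
    exact neg_le_neg h₁) this
  have : -w' y ≤ -w' (Pi.single k 1) := hw'
  simp only [map_smul, smul_eq_mul]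
  exact mul_le_mul_of_nonneg_left (by linarith) hs.le

lemma exists_mem_toExposed_summand (ha : ∀ i j, i ≤ j → 0 < a i j)
    (w : StrongDual ℝ (Fin (n + 1) → ℝ)) :
    ∃ y : (Σ _ : Fin (n + 1), Fin (n + 1)) → Fin (n + 1) → ℝ, ∀ x ∈ intervals n,
      y x ∈ w.toExposed (a x.1 x.2 • intervalSimplex x.1 x.2) := by
  have : ∀ x : (Σ _ : Fin (n + 1), Fin (n + 1)), x ∈ intervals n →
      ∃ y, y ∈ w.toExposed (a x.1 x.2 • intervalSimplex x.1 x.2) := by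
    intro x hx
    have hx' := mem_intervals.1 hx
    obtain ⟨k, hk, hmax⟩ := Set.exists_max_image (Icc x.1 x.2) (fun m => w (Pi.single m 1))
      (Set.toFinite _) ⟨x.1, le_rfl, hx'⟩
    exact ⟨_, (smul_single_mem_toExposed_iff w (ha _ _ hx') hk).2 hmax⟩
  choose! y hy using this
  exact ⟨y, hy⟩

lemma toExposed_minkowskiAss_nonempty (ha : ∀ i j, i ≤ j → 0 < a i j)
    (w : StrongDual ℝ (Fin (n + 1) → ℝ)) : (w.toExposed (minkowskiAss a)).Nonempty := by
  obtain ⟨y, hy⟩ := exists_mem_toExposed_summand ha w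
  rw [minkowskiAss_eq]
  exact ⟨_, (mem_toExposed_sum w fun x hx => (hy x hx).1).2 hy⟩

/-- Changing one summand of a point in a face of a Minkowski sum. -/
lemma exists_add_mem_toExposed (ha : ∀ i j, i ≤ j → 0 < a i j)
    (w : StrongDual ℝ (Fin (n + 1) → ℝ)) {i j : Fin (n + 1)} (hij : i ≤ j) :
    ∃ b : Fin (n + 1) → ℝ, ∀ z ∈ a i j • intervalSimplex i j, z + b ∈ minkowskiAss a ∧
      (z ∈ w.toExposed (a i j • intervalSimplex i j) → z + b ∈ w.toExposed (minkowskiAss a)) ∧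
      ∀ w' : StrongDual ℝ (Fin (n + 1) → ℝ), z + b ∈ w'.toExposed (minkowskiAss a) →
        z ∈ w'.toExposed (a i j • intervalSimplex i j) := by
  classical
  obtain ⟨y, hy⟩ := exists_mem_toExposed_summand ha w
  have hx₀ : (⟨i, j⟩ : Σ _ : Fin (n + 1), Fin (n + 1)) ∈ intervals n := mem_intervals.2 hij
  refine ⟨∑ x ∈ intervals n \ {⟨i, j⟩}, y x, fun z hz => ?_⟩
  have hmem : ∀ x ∈ intervals n, Function.update y ⟨i, j⟩ z x ∈
      a x.1 x.2 • intervalSimplex x.1 x.2 := by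
    intro x hx
    rcases eq_or_ne x ⟨i, j⟩ with rfl | hne
    · simpa using hz
    · simpa [hne] using (hy x hx).1
  rw [← Finset.sum_update_of_mem hx₀, minkowskiAss_eq, mem_toExposed_sum w hmem]
  refine ⟨Set.mem_finsetSum _ _ _ |>.2 ⟨_, fun {x} hx => hmem x hx, rfl⟩, fun hzw x hx => ?_,
    fun w' h => ?_⟩
  · rcases eq_or_ne x ⟨i, j⟩ with rfl | hne
    · simpa using hzw
    · simpa [hne] using hy x hx
  · simpa using (mem_toExposed_sum w' hmem).1 h ⟨i, j⟩ hx₀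

/-- Inclusion of faces in terms of the maxima on intervals. -/
lemma toExposed_minkowskiAss_subset_iff (ha : ∀ i j, i ≤ j → 0 < a i j)
    (w w' : StrongDual ℝ (Fin (n + 1) → ℝ)) :
    w.toExposed (minkowskiAss a) ⊆ w'.toExposed (minkowskiAss a) ↔
      ∀ i j, ∀ k ∈ Icc i j, (∀ m ∈ Icc i j, w (Pi.single m 1) ≤ w (Pi.single k 1)) →
        ∀ m ∈ Icc i j, w' (Pi.single m 1) ≤ w' (Pi.single k 1) := by
  constructor
  · intro h i j k hk hmax
    have hij := hk.1.trans hk.2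
    obtain ⟨b, hb⟩ := exists_add_mem_toExposed ha w hij
    have hz : a i j • Pi.single k 1 ∈ a i j • intervalSimplex i j :=
      smul_mem_smul_set (single_mem_intervalSimplex hk)
    obtain ⟨-, h₁, h₂⟩ := hb _ hz
    exact (smul_single_mem_toExposed_iff w' (ha i j hij) hk).1 (h₂ w' (h (h₁
      ((smul_single_mem_toExposed_iff w (ha i j hij) hk).2 hmax))))
  · intro h x hx
    rw [minkowskiAss_eq] at hx ⊢
    obtain ⟨y, hy, rfl⟩ := (Set.mem_finsetSum _ _ _).1 hx.1
    rw [mem_toExposed_sum w fun k hk => hy hk] at hx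
    rw [mem_toExposed_sum w' fun k hk => hy hk]
    intro x hx'
    have hij := mem_intervals.1 hx'
    exact toExposed_smul_intervalSimplex_subset (ha _ _ hij) hij (h x.1 x.2) (hx x hx')

/-- Two maxima on one interval would give two points of the face that differ only in the summand of
this interval. -/
lemma eq_of_toExposed_eq_singleton (ha : ∀ i j, i ≤ j → 0 < a i j)
    {w : StrongDual ℝ (Fin (n + 1) → ℝ)} {x : Fin (n + 1) → ℝ}
    (hw : w.toExposed (minkowskiAss a) = {x}) {i j k k' : Fin (n + 1)} (hk : k ∈ Icc i j)
    (hk' : k' ∈ Icc i j) (hmax : ∀ m ∈ Icc i j, w (Pi.single m 1) ≤ w (Pi.single k 1))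
    (hmax' : ∀ m ∈ Icc i j, w (Pi.single m 1) ≤ w (Pi.single k' 1)) : k = k' := by
  have hij := hk.1.trans hk.2
  obtain ⟨b, hb⟩ := exists_add_mem_toExposed ha w hij
  have h₁ := (hb _ (smul_mem_smul_set (single_mem_intervalSimplex hk))).2.1
    ((smul_single_mem_toExposed_iff w (ha i j hij) hk).2 hmax)
  have h₂ := (hb _ (smul_mem_smul_set (single_mem_intervalSimplex hk'))).2.1
    ((smul_single_mem_toExposed_iff w (ha i j hij) hk').2 hmax')
  rw [hw, mem_singleton_iff] at h₁ h₂
  have h₃ := add_right_cancel (h₁.trans h₂.symm)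
  have h₄ := smul_right_injective _ (ha i j hij).ne' h₃
  by_contra hne
  have := congrFun h₄ k
  simp [hne] at this

lemma isPolytope_minkowskiAss (a : Fin (n + 1) → Fin (n + 1) → ℝ) :
    IsPolytope (minkowskiAss a) := by
  refine ⟨∑ x ∈ intervals n, a x.1 x.2 •
    ((fun k : Fin (n + 1) => Pi.single k (1 : ℝ)) '' Icc x.1 x.2),
    finite_finsetSum _ fun x _ => (Set.toFinite _).smul_set, ?_⟩
  rw [convexHull_sum, minkowskiAss_eq]
  refine Finset.sum_congr rfl fun x _ => ?_
  rw [convexHull_smul, intervalSimplex]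

lemma sum_of_mem_intervalSimplex {i j : Fin (n + 1)} {x : Fin (n + 1) → ℝ}
    (hx : x ∈ intervalSimplex i j) : ∑ k, x k = 1 := by
  have hlin : IsLinearMap ℝ fun x : Fin (n + 1) → ℝ => ∑ k, x k :=
    ⟨fun x y => by simp [Finset.sum_add_distrib], fun c x => by simp [Finset.mul_sum]⟩
  refine convexHull_min (t := {x : Fin (n + 1) → ℝ | ∑ k, x k = 1}) ?_
    (convex_hyperplane hlin 1) hx
  rintro _ ⟨k, -, rfl⟩
  simp

lemma finrank_vectorSpan_minkowskiAss (ha : ∀ i j, i ≤ j → 0 < a i j) :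
    Module.finrank ℝ (vectorSpan ℝ (minkowskiAss a)) = n := by
  apply le_antisymm
  -- Upper bound: the coordinate sum is constant on the polytope, equal to the sum of all `a i j`.
  · set σ : Module.Dual ℝ (Fin (n + 1) → ℝ) := ∑ k, LinearMap.proj k with hσ
    have hσa : ∀ x, σ x = ∑ k, x k := fun x => by simp [hσ]
    have hσ0 : σ ≠ 0 := fun h => by
      have := hσa (Pi.single 0 1)
      simp [h] at this
    have hconst : ∀ x ∈ minkowskiAss a, σ x = ∑ x ∈ intervals n, a x.1 x.2 := by
      intro x hx
      rw [minkowskiAss_eq] at hx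
      obtain ⟨y, hy, rfl⟩ := (Set.mem_finsetSum _ _ _).1 hx
      rw [map_sum]
      refine Finset.sum_congr rfl fun k hk => ?_
      obtain ⟨z, hz, he⟩ := hy hk
      rw [← he]
      change σ (a k.1 k.2 • z) = a k.1 k.2
      rw [map_smul, hσa, sum_of_mem_intervalSimplex hz, smul_eq_mul, mul_one]
    have hle : vectorSpan ℝ (minkowskiAss a) ≤ LinearMap.ker σ := by
      rw [vectorSpan_def, Submodule.span_le]
      rintro _ ⟨x, hx, y, hy, rfl⟩
      simp [hconst x hx, hconst y hy]
    have h₁ := Submodule.finrank_mono hle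
    have h₂ := Module.Dual.finrank_ker_add_one_of_ne_zero hσ0
    rw [Module.finrank_fin_fun] at h₂
    omega
  · have hind : AffineIndependent ℝ fun k : Fin (n + 1) => (Pi.single k 1 : Fin (n + 1) → ℝ) := by
      have := (Pi.basisFun ℝ (Fin (n + 1))).linearIndependent.affineIndependent
      rwa [show ⇑(Pi.basisFun ℝ (Fin (n + 1))) = fun k => Pi.single k 1 from
        funext fun k => Pi.basisFun_apply ℝ (Fin (n + 1)) k] at this
    have hfin := hind.finrank_vectorSpan (Fintype.card_fin (n + 1))
    conv_lhs => rw [← hfin]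
    refine Submodule.finrank_mono ?_
    rw [vectorSpan_def, Submodule.span_le]
    rintro _ ⟨_, ⟨k, rfl⟩, _, ⟨k', rfl⟩, rfl⟩
    -- Lower bound: fixing the other summands leaves a translate of the dilated full simplex inside
    -- the polytope.
    obtain ⟨b, hb⟩ := exists_add_mem_toExposed ha 0 (Fin.zero_le (Fin.last n))
    have hmem : ∀ m : Fin (n + 1), a 0 (Fin.last n) • Pi.single m 1 + b ∈ minkowskiAss a :=
      fun m => (hb _ (smul_mem_smul_set (single_mem_intervalSimplex
        ⟨Fin.zero_le _, Fin.le_last _⟩))).1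
    have := vsub_mem_vectorSpan ℝ (hmem k) (hmem k')
    rw [vsub_eq_sub, add_sub_add_right_eq_sub, ← smul_sub] at this
    exact (Submodule.smul_mem_iff _ (ha _ _ (Fin.zero_le _)).ne').1 this

end Minkowski

/-! ### Faces and subdivisions -/

section Correspondence

open Set

variable {n : ℕ} {a : Fin (n + 1) → Fin (n + 1) → ℝ}

/-- The inner vertices of the polygon, as the coordinates of the polytope. -/
def innerVertex (i : Fin (n + 1)) : Fin (n + 3) := i.castSucc.succ

lemma innerVertex_mem (i : Fin (n + 1)) : innerVertex i ∈ Ioo (⊥ : Fin (n + 3)) ⊤ := by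
  constructor
  · exact Fin.succ_pos _
  · simp only [innerVertex, Fin.lt_def, Fin.val_succ, Fin.val_castSucc, Fin.top_eq_last,
      Fin.val_last]
    omega

lemma exists_innerVertex {k : Fin (n + 3)} (hk : k ∈ Ioo (⊥ : Fin (n + 3)) ⊤) :
    ∃ i, innerVertex i = k := by
  rcases Fin.eq_zero_or_eq_succ k with rfl | ⟨k', rfl⟩
  · exact absurd hk.1 (lt_irrefl _)
  rcases Fin.eq_castSucc_or_eq_last k' with ⟨i, rfl⟩ | rfl
  · exact ⟨i, rfl⟩
  · exact absurd hk.2 (lt_irrefl _)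

lemma innerVertex_le_iff {i j : Fin (n + 1)} : innerVertex i ≤ innerVertex j ↔ i ≤ j := by
  simp [innerVertex]

lemma vertexWeight_innerVertex (w : StrongDual ℝ (Fin (n + 1) → ℝ)) (i : Fin (n + 1)) :
    vertexWeight w (innerVertex i) = ((w (Pi.single i 1) : ℝ) : WithTop ℝ) := by
  rw [vertexWeight, innerVertex, Fin.cons_succ, Fin.snoc_castSucc]

lemma vertexWeight_bot (w : StrongDual ℝ (Fin (n + 1) → ℝ)) : vertexWeight w ⊥ = ⊤ := rfl

lemma vertexWeight_top (w : StrongDual ℝ (Fin (n + 1) → ℝ)) : vertexWeight w ⊤ = ⊤ := by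
  rw [vertexWeight, Fin.top_eq_last, ← Fin.succ_last, Fin.cons_succ, Fin.snoc_last]

lemma peaked_vertexWeight (w : StrongDual ℝ (Fin (n + 1) → ℝ)) : Peaked (vertexWeight w) := by
  intro k h₁ h₂
  obtain ⟨i, rfl⟩ := exists_innerVertex ⟨bot_lt_iff_ne_bot.2 h₁, lt_top_iff_ne_top.2 h₂⟩
  rw [vertexWeight_bot, vertexWeight_top, vertexWeight_innerVertex]
  exact ⟨WithTop.coe_lt_top _, WithTop.coe_lt_top _⟩

lemma maxFace_le_iff (ha : ∀ i j, i ≤ j → 0 < a i j) (w w' : StrongDual ℝ (Fin (n + 1) → ℝ)) :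
    maxFace a w ≤ maxFace a w' ↔
      ∀ l r, IsChord (vertexWeight w') l r → IsChord (vertexWeight w) l r := by
  rw [(peaked_vertexWeight w).isChord_imp_iff (peaked_vertexWeight w')]
  refine (toExposed_minkowskiAss_subset_iff ha w w').trans ⟨fun H => ?_, fun H => ?_⟩
  · intro i j hi hj k hk hmax m hm
    have hin : ∀ x ∈ Icc i j, ∃ x', innerVertex x' = x := fun x hx =>
      exists_innerVertex ⟨hi.trans_le hx.1, hx.2.trans_lt hj⟩
    have hij := hk.1.trans hk.2
    obtain ⟨i, rfl⟩ := hin i ⟨le_rfl, hij⟩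
    obtain ⟨j, rfl⟩ := hin j ⟨hij, le_rfl⟩
    obtain ⟨k, rfl⟩ := hin k hk
    obtain ⟨m, rfl⟩ := hin m hm
    simp only [vertexWeight_innerVertex, WithTop.coe_le_coe]
    refine H i j k ⟨innerVertex_le_iff.1 hk.1, innerVertex_le_iff.1 hk.2⟩ (fun x hx => ?_) m
      ⟨innerVertex_le_iff.1 hm.1, innerVertex_le_iff.1 hm.2⟩
    have := hmax (innerVertex x) ⟨innerVertex_le_iff.2 hx.1, innerVertex_le_iff.2 hx.2⟩
    simpa only [vertexWeight_innerVertex, WithTop.coe_le_coe] using this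
  · intro i j k hk hmax m hm
    have := H (innerVertex i) (innerVertex j) (innerVertex_mem i).1 (innerVertex_mem j).2
      (innerVertex k) ⟨innerVertex_le_iff.2 hk.1, innerVertex_le_iff.2 hk.2⟩ (fun x hx => by
        obtain ⟨x, rfl⟩ := exists_innerVertex
          ⟨(innerVertex_mem i).1.trans_le hx.1, hx.2.trans_lt (innerVertex_mem j).2⟩
        simp only [vertexWeight_innerVertex, WithTop.coe_le_coe]
        exact hmax x ⟨innerVertex_le_iff.1 hx.1, innerVertex_le_iff.1 hx.2⟩)
      (innerVertex m) ⟨innerVertex_le_iff.2 hm.1, innerVertex_le_iff.2 hm.2⟩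
    simpa only [vertexWeight_innerVertex, WithTop.coe_le_coe] using this

/-- Every noncrossing family of diagonals is the family of chords of a linear function. -/
lemma exists_isChord_vertexWeight_iff {N : Set (Fin (n + 3) × Fin (n + 3))}
    (hN : ∀ d ∈ N, (Ioo d.1 d.2).Nonempty)
    (hcross : ∀ d ∈ N, ∀ e ∈ N, d.1 < e.1 → e.1 < d.2 → d.2 < e.2 → False) :
    ∃ w : StrongDual ℝ (Fin (n + 1) → ℝ), ∀ l r,
      IsChord (vertexWeight w) l r ↔ (l = ⊥ ∧ r = ⊤) ∨ (l, r) ∈ N := by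
  -- The coordinate at a vertex is minus its depth, the number of members of `N` that strictly
  -- enclose it.
  refine ⟨∑ i, (-({d ∈ N | innerVertex i ∈ Ioo d.1 d.2}.ncard : ℝ)) •
    ContinuousLinearMap.proj (R := ℝ) (φ := fun _ : Fin (n + 1) => ℝ) i,
    (peaked_vertexWeight _).isChord_iff_of_noncrossing nonempty_Ioo_bot_top hN hcross ?_⟩
  intro i hi j hj
  obtain ⟨i, rfl⟩ := exists_innerVertex hi
  obtain ⟨j, rfl⟩ := exists_innerVertex hj
  simp only [vertexWeight_innerVertex, WithTop.coe_lt_coe]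
  simp [Pi.single_apply]

lemma levelCells_eq {p : Fin (n + 3) → Plane} (hp : IsConvexPolygon p)
    (w : StrongDual ℝ (Fin (n + 1) → ℝ)) : levelCells p w = chordPolygons p (vertexWeight w) :=
  commonRefinement_inducedCells hp (peaked_vertexWeight w)
    ((vertexWeight_bot w).trans (vertexWeight_top w).symm)

lemma exists_eq_maxFace (F : FaceLattice (minkowskiAss a)) (hF : F.1.Nonempty) :
    ∃ w, F = maxFace a w := by
  obtain ⟨w, hw⟩ := F.2 hF
  exact ⟨w, Subtype.ext hw⟩

/-- A nonempty face is sent to the chord subdivision of any function exposing it. The choice is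
harmless, since containment of faces and refinement are both reverse inclusion of chords. -/
theorem exists_orderIso (ha : ∀ i j, i ≤ j → 0 < a i j) {p : Fin (n + 3) → Plane}
    (hp : IsConvexPolygon p) : ∃ φ : FaceLattice (minkowskiAss a) ≃o SubdivisionLattice p,
      ∀ w, φ (maxFace a w) = (chordSubdivision hp (peaked_vertexWeight w) : WithBot _) := by
  classical
  set c : StrongDual ℝ (Fin (n + 1) → ℝ) → Subdivision p := fun w =>
    chordSubdivision hp (peaked_vertexWeight w) with hc
  have hle : ∀ w w', c w ≤ c w' ↔ maxFace a w ≤ maxFace a w' := fun w w' => by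
    rw [maxFace_le_iff ha, hc, chordSubdivision_le_iff]
  have hne : ∀ w, (maxFace a w).1.Nonempty := toExposed_minkowskiAss_nonempty ha
  choose W hW using exists_eq_maxFace (a := a)
  set f : FaceLattice (minkowskiAss a) → SubdivisionLattice p := fun F =>
    if h : F.1.Nonempty then (c (W F h) : WithBot _) else ⊥ with hf
  have hf_max : ∀ w, f (maxFace a w) = (c w : WithBot _) := by
    intro w
    have he := hW (maxFace a w) (hne w)
    rw [hf]
    simp only [dif_pos (hne w)]
    exact congrArg _ (Subdivision.le_antisymm ((hle _ _).2 he.ge) ((hle _ _).2 he.le))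
  have hf_le : ∀ F G, f F ≤ f G ↔ F ≤ G := by
    intro F G
    by_cases hF : F.1.Nonempty
    · by_cases hG : G.1.Nonempty
      · obtain ⟨w, rfl⟩ := exists_eq_maxFace F hF
        obtain ⟨w', rfl⟩ := exists_eq_maxFace G hG
        rw [hf_max, hf_max, WithBot.coe_le_coe, hle]
      · have h₁ : f G = ⊥ := dif_neg hG
        obtain ⟨w, rfl⟩ := exists_eq_maxFace F hF
        rw [h₁, hf_max]
        exact iff_of_false (WithBot.not_coe_le_bot _) fun h => hG (hF.mono h)
    · have h₁ : f F = ⊥ := dif_neg hF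
      rw [h₁]
      refine iff_of_true bot_le ?_
      have : F.1 = ∅ := not_nonempty_iff_eq_empty.1 hF
      change F.1 ⊆ G.1
      rw [this]
      exact empty_subset _
  have hinj : Function.Injective f := fun F G h =>
    le_antisymm ((hf_le F G).1 (by rw [h])) ((hf_le G F).1 (by rw [h]))
  have hsurj : Function.Surjective f := by
    intro T
    induction T using WithBot.recBotCoe with
    | bot =>
      refine ⟨⟨∅, fun h => absurd h not_nonempty_empty⟩, dif_neg ?_⟩
      exact not_nonempty_empty
    | coe S =>
      obtain ⟨w, hw⟩ := exists_isChord_vertexWeight_iff (N := S.diagonals) (fun d hd => hd.1)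
        (S.not_crossing hp)
      have := S.eq_chordSubdivision hp (peaked_vertexWeight w) fun l r => by
        -- The base side is itself in `S.diagonals`, so the extra pair adds nothing.
        rw [hw]
        refine or_iff_right_of_imp ?_
        rintro ⟨rfl, rfl⟩
        exact ⟨nonempty_Ioo_bot_top, fun A _ => Or.inl (subset_Icc_bot_top A)⟩
      exact ⟨maxFace a w, by rw [hf_max, this]⟩
  exact ⟨⟨Equiv.ofBijective f ⟨hinj, hsurj⟩, fun {F G} => hf_le F G⟩, hf_max⟩

end Correspondence

/-! ### Simplicity -/

section Simple

open Set

variable {n : ℕ} {a : Fin (n + 1) → Fin (n + 1) → ℝ}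

lemma exists_single_diagonal {d : Fin (n + 3) × Fin (n + 3)} (hd : (Ioo d.1 d.2).Nonempty) :
    ∃ w : StrongDual ℝ (Fin (n + 1) → ℝ), ∀ l r,
      IsChord (vertexWeight w) l r ↔ (l = ⊥ ∧ r = ⊤) ∨ (l, r) = d := by
  obtain ⟨w, hw⟩ := exists_isChord_vertexWeight_iff (N := {d})
    (by rintro _ rfl; exact hd) (by
      rintro _ rfl _ rfl h
      exact absurd h (lt_irrefl _))
  exact ⟨w, hw⟩

lemma isChord_zero_iff (l r : Fin (n + 3)) :
    IsChord (vertexWeight (0 : StrongDual ℝ (Fin (n + 1) → ℝ))) l r ↔ l = ⊥ ∧ r = ⊤ := by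
  constructor
  · intro h
    obtain ⟨k, hk⟩ := h.1
    obtain ⟨i, rfl⟩ := exists_innerVertex
      (k := k) ⟨bot_le.trans_lt hk.1, hk.2.trans_le le_top⟩
    have hlt := h.2 _ hk
    have key : ∀ x : Fin (n + 3), vertexWeight (0 : StrongDual ℝ (Fin (n + 1) → ℝ))
        (innerVertex i) < vertexWeight 0 x → x = ⊥ ∨ x = ⊤ := by
      intro x hx
      by_contra! hne
      obtain ⟨j, rfl⟩ := exists_innerVertex
        ⟨bot_lt_iff_ne_bot.2 hne.1, lt_top_iff_ne_top.2 hne.2⟩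
      simp [vertexWeight_innerVertex] at hx
    refine ⟨(key l hlt.1).resolve_right fun e => ?_, (key r hlt.2).resolve_left fun e => ?_⟩
    · exact not_top_lt (e ▸ h.lt)
    · exact not_lt_bot (e ▸ h.lt)
  · rintro ⟨rfl, rfl⟩
    exact isChord_bot_top (peaked_vertexWeight 0) nonempty_Ioo_bot_top

lemma isChord_vertexWeight_bot_top (w : StrongDual ℝ (Fin (n + 1) → ℝ)) :
    IsChord (vertexWeight w) ⊥ ⊤ :=
  isChord_bot_top (peaked_vertexWeight w) nonempty_Ioo_bot_top

/-- The zero function exposes the whole polytope and has the base side as its only chord. -/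
lemma toExposed_eq_self_iff (ha : ∀ i j, i ≤ j → 0 < a i j) (w : StrongDual ℝ (Fin (n + 1) → ℝ)) :
    w.toExposed (minkowskiAss a) = minkowskiAss a ↔
      ∀ l r, IsChord (vertexWeight w) l r → l = ⊥ ∧ r = ⊤ := by
  have h0 : (0 : StrongDual ℝ (Fin (n + 1) → ℝ)).toExposed (minkowskiAss a) = minkowskiAss a := by
    ext x
    exact ⟨fun h => h.1, fun h => ⟨h, fun y _ => le_rfl⟩⟩
  have := maxFace_le_iff ha 0 w
  simp only [isChord_zero_iff] at this
  rw [← this]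
  change _ ↔ (0 : StrongDual ℝ (Fin (n + 1) → ℝ)).toExposed (minkowskiAss a) ⊆
    w.toExposed (minkowskiAss a)
  rw [h0]
  exact ⟨fun h => h.ge, fun h => Subset.antisymm (fun x hx => hx.1) h⟩

/-- The facets containing a face are given by the diagonals of the corresponding subdivision. -/
lemma setOf_isFacet (ha : ∀ i j, i ≤ j → 0 < a i j) {w : StrongDual ℝ (Fin (n + 1) → ℝ)}
    {x : Fin (n + 1) → ℝ} (hw : w.toExposed (minkowskiAss a) = {x})
    {u : Fin (n + 3) × Fin (n + 3) → StrongDual ℝ (Fin (n + 1) → ℝ)}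
    (hu : ∀ d, (Ioo d.1 d.2).Nonempty → ∀ l r,
      IsChord (vertexWeight (u d)) l r ↔ (l = ⊥ ∧ r = ⊤) ∨ (l, r) = d) :
    {F | IsFacet (minkowskiAss a) F ∧ x ∈ F} = (fun d => (u d).toExposed (minkowskiAss a)) ''
      {d | IsChord (vertexWeight w) d.1 d.2 ∧ d ≠ (⊥, ⊤)} := by
  have hexp : ∀ w : StrongDual ℝ (Fin (n + 1) → ℝ),
      IsExposed ℝ (minkowskiAss a) (w.toExposed (minkowskiAss a)) := fun w =>
    ContinuousLinearMap.toExposed.isExposed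
  have hsub : ∀ w' : StrongDual ℝ (Fin (n + 1) → ℝ), x ∈ w'.toExposed (minkowskiAss a) ↔
      maxFace a w ≤ maxFace a w' := fun w' => by
    change _ ↔ w.toExposed (minkowskiAss a) ⊆ w'.toExposed (minkowskiAss a)
    rw [hw, singleton_subset_iff]
  have hune : ∀ d : Fin (n + 3) × Fin (n + 3), (Ioo d.1 d.2).Nonempty → d ≠ (⊥, ⊤) →
      (u d).toExposed (minkowskiAss a) ≠ minkowskiAss a := by
    intro d hd hne h
    have := (toExposed_eq_self_iff ha (u d)).1 h d.1 d.2 ((hu d hd d.1 d.2).2 (Or.inr rfl))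
    exact hne (Prod.ext this.1 this.2)
  ext F
  constructor
  · rintro ⟨hF, hxF⟩
    obtain ⟨w', rfl⟩ : ∃ w' : StrongDual ℝ (Fin (n + 1) → ℝ),
        F = w'.toExposed (minkowskiAss a) := hF.prop.1 ⟨x, hxF⟩
    have hne := hF.prop.2
    rw [ne_eq, toExposed_eq_self_iff ha] at hne
    push Not at hne
    obtain ⟨l, r, hlr, hne⟩ := hne
    have hd : (l, r) ≠ (⊥, ⊤) := fun h => by
      obtain ⟨h₁, h₂⟩ := Prod.mk.inj h
      exact hne h₁ h₂
    -- A proper face has a diagonal and so lies in the proper face of this diagonal alone;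
    -- maximality makes them equal.
    have hle : maxFace a w' ≤ maxFace a (u (l, r)) := by
      rw [maxFace_le_iff ha]
      intro i j hij
      rcases (hu (l, r) hlr.1 i j).1 hij with ⟨rfl, rfl⟩ | h
      · exact isChord_vertexWeight_bot_top _
      · obtain ⟨rfl, rfl⟩ := Prod.mk.inj h
        exact hlr
    refine ⟨(l, r), ⟨(maxFace_le_iff ha w w').1 ((hsub w').1 hxF) l r hlr, hd⟩, ?_⟩
    exact Subset.antisymm (hF.2 ⟨hexp _, hune _ hlr.1 hd⟩ hle) hle
  · rintro ⟨d, ⟨hd, hne⟩, rfl⟩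
    refine ⟨⟨⟨hexp _, hune d hd.1 hne⟩, ?_⟩, ?_⟩
    -- A larger proper face has a diagonal too, and this can only be `d`.
    · rintro G ⟨hG, hGne⟩ hle
      obtain ⟨w', rfl⟩ : ∃ w' : StrongDual ℝ (Fin (n + 1) → ℝ),
          G = w'.toExposed (minkowskiAss a) :=
        hG ((toExposed_minkowskiAss_nonempty ha (u d)).mono hle)
      have hch := (maxFace_le_iff ha (u d) w').1 hle
      refine (maxFace_le_iff ha w' (u d)).2 fun l r hlr => ?_
      rw [ne_eq, toExposed_eq_self_iff ha] at hGne
      push Not at hGne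
      obtain ⟨i, j, hij, hijne⟩ := hGne
      rcases (hu d hd.1 l r).1 hlr with ⟨rfl, rfl⟩ | h
      · exact isChord_vertexWeight_bot_top _
      rcases (hu d hd.1 i j).1 (hch i j hij) with h' | h'
      · exact absurd h'.2 (hijne h'.1)
      · obtain ⟨rfl, rfl⟩ := Prod.mk.inj (h.trans h'.symm)
        exact hij
    · refine (hsub _).2 ((maxFace_le_iff ha _ _).2 fun l r hlr => ?_)
      rcases (hu d hd.1 l r).1 hlr with ⟨rfl, rfl⟩ | h
      · exact isChord_vertexWeight_bot_top _
      · rw [← h] at hd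
        exact hd

lemma isSimplePolytope_minkowskiAss (ha : ∀ i j, i ≤ j → 0 < a i j) :
    IsSimplePolytope n (minkowskiAss a) := by
  refine ⟨isPolytope_minkowskiAss a,
    (toExposed_minkowskiAss_nonempty ha 0).mono fun x hx => hx.1,
    finrank_vectorSpan_minkowskiAss ha, fun x hx => ?_⟩
  obtain ⟨w, hw⟩ := (isPolytope_minkowskiAss a).exists_toExposed_eq_singleton hx
  choose! u hu using fun (d : Fin (n + 3) × Fin (n + 3)) (hd : (Ioo d.1 d.2).Nonempty) =>
    exists_single_diagonal (n := n) hd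
  rw [setOf_isFacet ha hw hu, InjOn.encard_image]
  · have hcard := (peaked_vertexWeight w).encard_isChord (by
      intro k hk k' hk' hlt he
      by_contra! hno
      obtain ⟨i, rfl⟩ := exists_innerVertex hk
      obtain ⟨j, rfl⟩ := exists_innerVertex hk'
      simp only [vertexWeight_innerVertex, WithTop.coe_inj] at he
      have hij : i ≤ j := innerVertex_le_iff.1 hlt.le
      have hmax : ∀ m ∈ Icc i j, w (Pi.single m 1) ≤ w (Pi.single i 1) := fun m hm => by
        have := hno (innerVertex m) ⟨innerVertex_le_iff.2 hm.1, innerVertex_le_iff.2 hm.2⟩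
        simpa only [vertexWeight_innerVertex, WithTop.coe_le_coe] using this
      have := eq_of_toExposed_eq_singleton ha hw (i := i) (j := j) ⟨le_rfl, hij⟩ ⟨hij, le_rfl⟩
        hmax (fun m hm => (hmax m hm).trans he.le)
      rw [this] at hlt
      exact lt_irrefl _ hlt)
    have hinner : (Ioo (⊥ : Fin (n + 3)) ⊤).encard = n + 1 := by
      have : (Ioo (⊥ : Fin (n + 3)) ⊤) = innerVertex '' univ := by
        ext k
        constructor
        · intro hk
          obtain ⟨i, rfl⟩ := exists_innerVertex hk
          exact ⟨i, mem_univ _, rfl⟩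
        · rintro ⟨i, -, rfl⟩
          exact innerVertex_mem i
      rw [this, InjOn.encard_image, encard_univ]
      · simp
      · exact fun i _ j _ h => le_antisymm (innerVertex_le_iff.1 h.le) (innerVertex_le_iff.1 h.ge)
    have hins : {d : Fin (n + 3) × Fin (n + 3) | IsChord (vertexWeight w) d.1 d.2} =
        insert (⊥, ⊤) {d | IsChord (vertexWeight w) d.1 d.2 ∧ d ≠ (⊥, ⊤)} := by
      ext d
      constructor
      · intro hd
        by_cases h : d = (⊥, ⊤)
        · exact Or.inl h
        · exact Or.inr ⟨hd, h⟩
      · rintro (rfl | h)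
        · exact isChord_vertexWeight_bot_top w
        · exact h.1
    -- Of the `n + 1` chords the base side is dropped, because its face is the whole polytope.
    rw [hinner, hins, encard_insert_of_notMem fun h => h.2 rfl] at hcard
    exact WithTop.add_right_cancel ENat.one_ne_top hcard
  · rintro d ⟨hd, hne⟩ e ⟨he, -⟩ h
    have hle : maxFace a (u e) ≤ maxFace a (u d) := le_of_eq (Subtype.ext h.symm)
    have := (maxFace_le_iff ha _ _).1 hle d.1 d.2 ((hu d hd.1 d.1 d.2).2 (Or.inr rfl))
    rcases (hu e he.1 d.1 d.2).1 this with h' | h'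
    · exact absurd (Prod.ext h'.1 h'.2) hne
    · exact h'

end Simple

theorem theorem3 (n : ℕ) (a : Fin (n + 1) → Fin (n + 1) → ℝ) (ha : ∀ i j, i ≤ j → 0 < a i j)
    (p : Fin (n + 3) → Plane) (hp : IsConvexPolygon p) :
    (∃ φ : FaceLattice (minkowskiAss a) ≃o SubdivisionLattice p,
      ∀ w : StrongDual ℝ (Fin (n + 1) → ℝ),
        ∃ S : Subdivision p, S.cells = levelCells p w ∧ φ (maxFace a w) = (S : WithBot _)) ∧
      IsAssociahedron n (minkowskiAss a) := by
  refine ⟨?_, isSimplePolytope_minkowskiAss ha, fun q hq => ⟨(exists_orderIso ha hq).choose⟩⟩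
  obtain ⟨φ, hφ⟩ := exists_orderIso ha hp
  exact ⟨φ, fun w => ⟨chordSubdivision hp (peaked_vertexWeight w), (levelCells_eq hp w).symm, hφ w⟩⟩
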